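/- Let $X$ be a second-countable locally compact Hausdorff space, let $\mathfrak M^+$ be the cone of positive Radon measures on $X$, and let $\kappa:X\times X\to[0,\infty]$ be a kernel, that is, a symmetric lower semicontinuous function. For $\mu,\nu\in\mathfrak M^+$ put $U^\mu(x)=\int\kappa(x,y)\,d\mu(y)$, $I(\mu,\nu)=\int\kappa\,d(\mu\otimes\nu)$, $I(\mu)=I(\mu,\mu)$, and let $\mathcal E^+=\{\mu\in\mathfrak M^+: I(\mu)<\infty\}$. These notions extend to signed Radon measures whenever the integrals are well defined. Assume: * (energy principle) $I(\sigma)\ge0$ for all signed Radon measures $\sigma$ for which $I(\sigma)$ is defined, with $I(\sigma)=0$ only for $\sigma=0$; so $\|\mu-\nu\|=\sqrt{I(\mu-\nu)}$ is a metric on $\mathcal E^+$, and its topology is called strong; * (consistency principle) $\mathcal E^+$ is strongly complete, and the strong topology on $\mathcal E^+$ is finer than the vague topology (pointwise convergence on continuous functions of compact support); * (domination principle) if $\mu\in\mathcal E^+$, $\nu\in\mathfrak M^+$ and $U^\mu\le U^\nu$ $\mu$-a.e., then $U^\mu\le U^\nu$ on $X$; * (Ugaheri's maximum principle) there is $M\in[1,\infty)$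 such that, for all $\mu\in\mathcal E^+$ and $c\in(0,\infty)$, if $U^\mu\le c$ $\mu$-a.e., then $U^\mu\le Mc$ on $X$. If this holds with $M=1$, it is called Frostman's maximum principle. For $A\subset X$ let $c_*(A)$ be the supremum over compact $K\subset A$ of $1/w(K)$, where $w(K)$ is the infimum of $I(\mu)$ over all $\mu\in\mathfrak M^+$ with $\mu(X\setminus K)=0$ and $\mu(X)=1$ (with $w(K)=\infty$ if there are none), and let $c^*(A)=\inf\{c_*(G): G\supset A \text{ open}\}$. A property holds n.e. on $A$ if the set of points of $A$ where it fails has $c_*$ equal to zero. The set $A$ is quasiclosed if $\inf\{c^*(A\bigtriangleup F): F\subset X\text{ closed}\}=0$. Let $\mathcal E^+(A)$ be the set of $\mu\in\mathcal E^+$ for which $X\setminus A$ is $\mu$-negligible. Let $(A_j)_{j\ge1}$ be a decreasing sequence of quasiclosed sets whose intersection $A$ satisfies $c_*(A)>0$. Let $\omega\in\mathfrak M^+$, $\omega\ne0$, be such that either $\omega\in\mathcal E^+$, or $\omega(X)<\infty$, $U^\omega|_K$ is upper semicontinuous for every compact $K\subset A_1$, and $U^\omega$ is bounded on $A_1$.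 Put $f=-U^\omega$. For $B=A$ and for $B=A_j$, let $\lambda_{B,f}$ denote the solution of the problem of minimizing $$I_f(\mu)=I(\mu)+2\int f\,d\mu$$ over all $\mu\in\mathcal E^+(B)$ with $\mu(X)=1$ (for these $\mu$, $f$ is automatically $\mu$-integrable), and let $c_{B,f}=\int (U^{\lambda_{B,f}}+f)\,d\lambda_{B,f}$. **Theorem.** There is a unique measure $\omega^A\in\mathcal E^+(A)$ with $U^{\omega^A}=U^\omega$ n.e. on $A$ (the inner balayage of $\omega$ onto $A$). Assume that at least one of the following holds: (i) $c_*(A_1)<\infty$; (ii) Frostman's maximum principle holds and $\omega^A(X)>1$. Then the solutions $\lambda_{A_j,f}$ ($j\ge1$) and $\lambda_{A,f}$ exist and are unique, $\lambda_{A_j,f}\to\lambda_{A,f}$ as $j\to\infty$ both strongly (i.e. $\|\lambda_{A_j,f}-\lambda_{A,f}\|\to0$) and vaguely, and $\lim_{j\to\infty}c_{A_j,f}=c_{A,f}$. -/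

import Mathlib

open Filter Topology MeasureTheory Set
open scoped ENNReal NNReal CompactlySupported

noncomputable section

/-- `κ` is a kernel: a symmetric, lower semicontinuous function `X × X → [0, ∞]`. -/
structure IsKernel {X : Type*} [TopologicalSpace X] (κ : X → X → ℝ≥0∞) : Prop where
  symm : ∀ x y, κ x y = κ y x
  lsc : LowerSemicontinuous (fun p : X × X => κ p.1 p.2)

/-- The cone `𝔐⁺` of positive Radon measures. On a second-countable locally compact Hausdorff
space these are exactly the Borel measures which are finite on compact sets. -/
def radonCone (X : Type*) [TopologicalSpace X] [MeasurableSpace X] : Set (Measure X) :=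
  {μ | IsFiniteMeasureOnCompacts μ}

section Basic

variable {X : Type*} [MeasurableSpace X]

/-- The potential `U^μ(x) = ∫ κ(x, y) dμ(y)` of a positive measure. -/
def potential (κ : X → X → ℝ≥0∞) (μ : Measure X) (x : X) : ℝ≥0∞ :=
  ∫⁻ y, κ x y ∂μ

/-- The mutual energy `I(μ, ν) = ∫ κ d(μ ⊗ ν)` of positive measures. -/
def mutualEnergy (κ : X → X → ℝ≥0∞) (μ ν : Measure X) : ℝ≥0∞ :=
  ∫⁻ p, κ p.1 p.2 ∂(μ.prod ν)

/-- The energy `I(μ) = I(μ, μ)`. -/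
def energy (κ : X → X → ℝ≥0∞) (μ : Measure X) : ℝ≥0∞ :=
  mutualEnergy κ μ μ

/-- The strong distance `‖μ - ν‖ = √(I(μ) + I(ν) - 2 I(μ, ν))` between positive measures of
finite energy. -/
def strongDist (κ : X → X → ℝ≥0∞) (μ ν : Measure X) : ℝ :=
  Real.sqrt ((energy κ μ).toReal + (energy κ ν).toReal - 2 * (mutualEnergy κ μ ν).toReal)

end Basic

section Potential

variable {X : Type*} [TopologicalSpace X] [MeasurableSpace X]

/-- The cone `𝓔⁺` of positive Radon measures of finite energy. -/
def energyCone (κ : X → X → ℝ≥0∞) : Set (Measure X) :=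
  {μ | μ ∈ radonCone X ∧ energy κ μ ≠ ∞}

/-- The cone `𝓔⁺(A)` of those `μ ∈ 𝓔⁺` that are concentrated on `A`
(the complement of `A` is `μ`-negligible). -/
def energyConeOn (κ : X → X → ℝ≥0∞) (A : Set X) : Set (Measure X) :=
  {μ | μ ∈ energyCone κ ∧ μ Aᶜ = 0}

/-- The energy principle (strict positive definiteness): `I(σ) ≥ 0` for every signed Radon
measure `σ`, with equality only for `σ = 0`. A signed Radon measure is a difference
`σ = μ - ν` with `μ, ν ∈ 𝔐⁺`, and `I(σ) = I(μ) + I(ν) - 2 I(μ, ν)`. If `μ, ν` are the positive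
and negative parts of `σ` and one of them has infinite energy, then `I(σ)` is `+∞` or
undefined, so that only `μ, ν ∈ 𝓔⁺` matter. -/
def EnergyPrinciple (κ : X → X → ℝ≥0∞) : Prop :=
  ∀ μ ∈ energyCone κ, ∀ ν ∈ energyCone κ,
    2 * mutualEnergy κ μ ν ≤ energy κ μ + energy κ ν ∧
      (2 * mutualEnergy κ μ ν = energy κ μ + energy κ ν → μ = ν)

/-- The consistency principle: the cone `𝓔⁺` is complete in the strong metric, and the strong
topology on `𝓔⁺` is finer than the vague topology. -/
structure ConsistencyPrinciple (κ : X → X → ℝ≥0∞) : Prop where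
  complete : ∀ μ : ℕ → Measure X, (∀ j, μ j ∈ energyCone κ) →
    (∀ ε > 0, ∃ N, ∀ i ≥ N, ∀ j ≥ N, strongDist κ (μ i) (μ j) < ε) →
    ∃ ν ∈ energyCone κ, Tendsto (fun j => strongDist κ (μ j) ν) atTop (𝓝 0)
  strong_finer_vague : ∀ μ ∈ energyCone κ, ∀ φ : C_c(X, ℝ), ∀ ε > 0, ∃ δ > 0,
    ∀ ν ∈ energyCone κ, strongDist κ ν μ < δ → |∫ x, φ x ∂ν - ∫ x, φ x ∂μ| < ε

/-- The domination principle. -/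
def DominationPrinciple (κ : X → X → ℝ≥0∞) : Prop :=
  ∀ μ ∈ energyCone κ, ∀ ν ∈ radonCone X,
    (∀ᵐ x ∂μ, potential κ μ x ≤ potential κ ν x) → ∀ x, potential κ μ x ≤ potential κ ν x

/-- Ugaheri's maximum principle with the constant `M`. -/
def UgaheriPrincipleWith (κ : X → X → ℝ≥0∞) (M : ℝ≥0) : Prop :=
  ∀ μ ∈ energyCone κ, ∀ c : ℝ≥0, 0 < c →
    (∀ᵐ x ∂μ, potential κ μ x ≤ c) → ∀ x, potential κ μ x ≤ M * c

/-- Ugaheri's maximum principle: it holds with some constant `M ∈ [1, ∞)`. -/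
def UgaheriPrinciple (κ : X → X → ℝ≥0∞) : Prop :=
  ∃ M : ℝ≥0, 1 ≤ M ∧ UgaheriPrincipleWith κ M

/-- Frostman's maximum principle: Ugaheri's maximum principle with `M = 1`. -/
def FrostmanPrinciple (κ : X → X → ℝ≥0∞) : Prop :=
  UgaheriPrincipleWith κ 1

/-- The minimal energy `w(K)` of a unit positive measure concentrated on `K`
(`∞` if there is no such measure). -/
def wiener (κ : X → X → ℝ≥0∞) (K : Set X) : ℝ≥0∞ :=
  ⨅ μ ∈ {μ : Measure X | μ ∈ radonCone X ∧ μ Kᶜ = 0 ∧ μ univ = 1}, energy κ μ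

/-- The inner capacity `c_*(A) = sup {1 / w(K) : K ⊆ A compact}`. -/
def innerCapacity (κ : X → X → ℝ≥0∞) (A : Set X) : ℝ≥0∞ :=
  ⨆ K ∈ {K : Set X | IsCompact K ∧ K ⊆ A}, (wiener κ K)⁻¹

/-- The outer capacity `c^*(A) = inf {c_*(G) : G ⊇ A open}`. -/
def outerCapacity (κ : X → X → ℝ≥0∞) (A : Set X) : ℝ≥0∞ :=
  ⨅ G ∈ {G : Set X | IsOpen G ∧ A ⊆ G}, innerCapacity κ G

/-- `P` holds nearly everywhere on `A`. -/
def NearlyEverywhereOn (κ : X → X → ℝ≥0∞) (A : Set X) (P : X → Prop) : Prop :=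
  innerCapacity κ {x ∈ A | ¬ P x} = 0

/-- `A` is quasiclosed: `inf {c^*(A ∆ F) : F closed} = 0`. -/
def IsQuasiclosed (κ : X → X → ℝ≥0∞) (A : Set X) : Prop :=
  (⨅ F ∈ {F : Set X | IsClosed F}, outerCapacity κ (symmDiff A F)) = 0

/-- The conditions on `ω ∈ 𝔐⁺` relative to a set `A`: either `ω` has finite energy, or `ω` is
bounded, its potential is upper semicontinuous on every compact subset of `A`, and its potential
is bounded on `A`. -/
def IsAdmissibleSource (κ : X → X → ℝ≥0∞) (ω : Measure X) (A : Set X) : Prop :=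
  energy κ ω ≠ ∞ ∨
    (ω univ < ∞ ∧
      (∀ K : Set X, IsCompact K → K ⊆ A → UpperSemicontinuousOn (potential κ ω) K) ∧
      ∃ C : ℝ≥0, ∀ x ∈ A, potential κ ω x ≤ C)

/-- `ν` is the inner balayage of `ω` onto `A`: `ν ∈ 𝓔⁺(A)` and `U^ν = U^ω` n.e. on `A`. -/
def IsInnerBalayage (κ : X → X → ℝ≥0∞) (ω : Measure X) (A : Set X) (ν : Measure X) : Prop :=
  ν ∈ energyConeOn κ A ∧ NearlyEverywhereOn κ A (fun x => potential κ ν x = potential κ ω x)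

/-- The Gauss functional `I_f(μ) = ‖μ‖² + 2 ∫ f dμ` for the external field `f = -U^ω`
(used for measures `μ` of finite energy for which `f` is integrable). -/
def gaussFunctional (κ : X → X → ℝ≥0∞) (ω μ : Measure X) : ℝ :=
  (energy κ μ).toReal + 2 * ∫ x, -(potential κ ω x).toReal ∂μ

/-- The class of unit measures `μ ∈ 𝓔⁺(A)` for which the external field `f = -U^ω` is
`μ`-integrable. -/
def gaussClass (κ : X → X → ℝ≥0∞) (ω : Measure X) (A : Set X) : Set (Measure X) :=
  {μ | μ ∈ energyConeOn κ A ∧ μ univ = 1 ∧ ∫⁻ x, potential κ ω x ∂μ ≠ ∞}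

/-- `l` is the solution `λ_{A,f}` of the inner Gauss variational problem for `A` and
`f = -U^ω`. -/
def IsGaussSolution (κ : X → X → ℝ≥0∞) (ω : Measure X) (A : Set X) (l : Measure X) : Prop :=
  l ∈ gaussClass κ ω A ∧ ∀ μ ∈ gaussClass κ ω A, gaussFunctional κ ω l ≤ gaussFunctional κ ω μ

/-- The constant `∫ U_f^l dl`, where `U_f^l = U^l + f` and `f = -U^ω`. For `l = λ_{A,f}` this is
the inner `f`-weighted equilibrium constant `c_{A,f}`. -/
def weightedConstant (κ : X → X → ℝ≥0∞) (ω l : Measure X) : ℝ :=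
  ∫ x, ((potential κ l x).toReal + -(potential κ ω x).toReal) ∂l

/-- Strong convergence of a sequence in `𝓔⁺`. -/
def StrongTendsto (κ : X → X → ℝ≥0∞) (μ : ℕ → Measure X) (ν : Measure X) : Prop :=
  Tendsto (fun j => strongDist κ (μ j) ν) atTop (𝓝 0)

/-- Vague convergence of a sequence of positive Radon measures. -/
def VagueTendsto (μ : ℕ → Measure X) (ν : Measure X) : Prop :=
  ∀ φ : C_c(X, ℝ), Tendsto (fun j => ∫ x, φ x ∂(μ j)) atTop (𝓝 (∫ x, φ x ∂ν))

end Potential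

end

/-! For measures of finite energy on A₁ (here `A 0`), integrating U^ω amounts to pairing with the
balayage ν₀ of ω onto A₁, since an equality n.e. on A₁ holds almost everywhere for each of them.
Hence I_f(μ) = ‖μ - ν₀‖² - ‖ν₀‖², and the Gauss problem is a metric projection onto a convex set. By
the parallelogram identity, almost minimizers over a decreasing sequence of convex sets are Cauchy,
and strong completeness provides a limit (`exists_strongTendsto_of_almost_minimizers`). If the sets
are strongly closed, the limit of the minimizers minimizes over the intersection, and the constants
converge along with energies and pairings.

Closedness has two halves. Concentration on a quasiclosed set survives strong limits because, under
an energy bound, sets of small capacity carry little mass. The condition of mass one is more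
delicate, as mass may escape to infinity. In case (i) unit measures far out in a set of finite
capacity have arbitrarily large energy, so bounded energy forbids the escape. In case (ii) the
condition is relaxed to mass at most one, which passes to vague limits; a minimizer of smaller mass
could be varied in all directions, hence would be the balayage onto its set, whose mass exceeds one
by monotonicity under Frostman's principle.

The balayage is found by minimizing I(μ) - 2∫U^ω dμ over 𝓔⁺(A): the Euler conditions give U^ω ≤ U^P
n.e. with equality P-a.e., and the domination principle gives the reverse inequality
(`exists_projection`). For ω of the second type this is done on compact subsets of A, where U^ω is
continuous. Ugaheri's principle bounds the energies of these balayages, and a Pythagorean identity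
turns the bound into strong convergence. -/

set_option linter.unusedSectionVars false

/-! ### The energy form and the strong metric. -/

section EnergyForm

variable {X : Type*} [TopologicalSpace X] [T2Space X] [LocallyCompactSpace X]
  [SecondCountableTopology X] [MeasurableSpace X] [BorelSpace X] {κ : X → X → ℝ≥0∞}

lemma IsKernel.measurable (hκ : IsKernel κ) : Measurable (fun p : X × X => κ p.1 p.2) :=
  hκ.lsc.measurable

lemma sigmaFinite_of_mem_radonCone {μ : Measure X} (hμ : μ ∈ radonCone X) : SigmaFinite μ := by
  have : IsFiniteMeasureOnCompacts μ := hμ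
  infer_instance

lemma IsKernel.measurable_potential (hκ : IsKernel κ) {μ : Measure X} (hμ : μ ∈ radonCone X) :
    Measurable (potential κ μ) := by
  have := sigmaFinite_of_mem_radonCone hμ
  exact hκ.measurable.lintegral_prod_right'

lemma mutualEnergy_eq_lintegral (hκ : IsKernel κ) {μ ν : Measure X} (hν : ν ∈ radonCone X) :
    mutualEnergy κ μ ν = ∫⁻ x, potential κ ν x ∂μ := by
  have := sigmaFinite_of_mem_radonCone hν
  exact lintegral_prod _ hκ.measurable.aemeasurable

lemma mutualEnergy_comm (hκ : IsKernel κ) {μ ν : Measure X} (hμ : μ ∈ radonCone X)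
    (hν : ν ∈ radonCone X) : mutualEnergy κ μ ν = mutualEnergy κ ν μ := by
  have := sigmaFinite_of_mem_radonCone hν
  have := sigmaFinite_of_mem_radonCone hμ
  rw [mutualEnergy_eq_lintegral hκ hμ, mutualEnergy_eq_lintegral hκ hν]
  unfold potential
  rw [lintegral_lintegral_swap hκ.measurable.aemeasurable]
  simp_rw [hκ.symm]

lemma zero_mem_radonCone : (0 : Measure X) ∈ radonCone X := by
  change IsFiniteMeasureOnCompacts (0 : Measure X)
  infer_instance

lemma add_mem_radonCone {μ ν : Measure X} (hμ : μ ∈ radonCone X) (hν : ν ∈ radonCone X) :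
    μ + ν ∈ radonCone X := by
  have : IsFiniteMeasureOnCompacts μ := hμ
  have : IsFiniteMeasureOnCompacts ν := hν
  exact ⟨fun K hK => by
    simpa using ⟨hK.measure_lt_top (μ := μ), hK.measure_lt_top (μ := ν)⟩⟩

lemma smul_mem_radonCone {μ : Measure X} (hμ : μ ∈ radonCone X) (c : ℝ≥0) :
    c • μ ∈ radonCone X := by
  have : IsFiniteMeasureOnCompacts μ := hμ
  exact ⟨fun K hK => by
    rw [Measure.smul_apply, ENNReal.smul_def, smul_eq_mul]
    exact ENNReal.mul_lt_top ENNReal.coe_lt_top hK.measure_lt_top⟩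

lemma mem_radonCone_of_le {μ ν : Measure X} (hμ : μ ∈ radonCone X) (h : ν ≤ μ) :
    ν ∈ radonCone X := by
  have : IsFiniteMeasureOnCompacts μ := hμ
  exact ⟨fun K hK => (h K).trans_lt hK.measure_lt_top⟩

lemma mutualEnergy_add_left (hκ : IsKernel κ) {μ ν ρ : Measure X} (hρ : ρ ∈ radonCone X) :
    mutualEnergy κ (μ + ν) ρ = mutualEnergy κ μ ρ + mutualEnergy κ ν ρ := by
  simp_rw [mutualEnergy_eq_lintegral hκ hρ, lintegral_add_measure]

lemma mutualEnergy_smul_left (hκ : IsKernel κ) {μ ρ : Measure X} (hρ : ρ ∈ radonCone X)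
    (c : ℝ≥0) : mutualEnergy κ (c • μ) ρ = c * mutualEnergy κ μ ρ := by
  simp_rw [mutualEnergy_eq_lintegral hκ hρ, lintegral_smul_measure, ENNReal.smul_def, smul_eq_mul]

lemma mutualEnergy_mono_left (hκ : IsKernel κ) {μ ν ρ : Measure X} (hρ : ρ ∈ radonCone X)
    (h : μ ≤ ν) : mutualEnergy κ μ ρ ≤ mutualEnergy κ ν ρ := by
  simp_rw [mutualEnergy_eq_lintegral hκ hρ]
  exact lintegral_mono' h le_rfl

lemma energy_mono (hκ : IsKernel κ) {μ ν : Measure X} (hν : ν ∈ radonCone X)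
    (h : μ ≤ ν) : energy κ μ ≤ energy κ ν := by
  have hμ := mem_radonCone_of_le hν h
  refine (mutualEnergy_mono_left hκ hμ h).trans ?_
  rw [mutualEnergy_comm hκ hν hμ]
  exact mutualEnergy_mono_left hκ hν h

lemma energy_smul (hκ : IsKernel κ) {μ : Measure X} (hμ : μ ∈ radonCone X)
    (c : ℝ≥0) : energy κ (c • μ) = c ^ 2 * energy κ μ := by
  unfold energy
  rw [mutualEnergy_smul_left hκ (smul_mem_radonCone hμ c),
    mutualEnergy_comm hκ hμ (smul_mem_radonCone hμ c), mutualEnergy_smul_left hκ hμ, sq, mul_assoc]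

lemma zero_mem_energyCone : (0 : Measure X) ∈ energyCone κ :=
  ⟨zero_mem_radonCone, by simp [energy, mutualEnergy]⟩

lemma mutualEnergy_ne_top (hE : EnergyPrinciple κ) {μ ν : Measure X} (hμ : μ ∈ energyCone κ)
    (hν : ν ∈ energyCone κ) : mutualEnergy κ μ ν ≠ ∞ := by
  intro h
  have := (hE μ hμ ν hν).1
  rw [h, ENNReal.mul_top (by simp), top_le_iff, ENNReal.add_eq_top] at this
  exact this.elim hμ.2 hν.2

lemma mem_energyCone_of_le (hκ : IsKernel κ) {μ ν : Measure X} (hμ : μ ∈ energyCone κ)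
    (h : ν ≤ μ) : ν ∈ energyCone κ :=
  ⟨mem_radonCone_of_le hμ.1 h, ((energy_mono hκ hμ.1 h).trans_lt hμ.2.lt_top).ne⟩

lemma smul_mem_energyCone (hκ : IsKernel κ) {μ : Measure X} (hμ : μ ∈ energyCone κ) (c : ℝ≥0) :
    c • μ ∈ energyCone κ :=
  ⟨smul_mem_radonCone hμ.1 c, by
    rw [energy_smul hκ hμ.1]
    exact ENNReal.mul_ne_top (by simp) hμ.2⟩

lemma add_mem_energyCone (hκ : IsKernel κ) (hE : EnergyPrinciple κ) {μ ν : Measure X}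
    (hμ : μ ∈ energyCone κ) (hν : ν ∈ energyCone κ) : μ + ν ∈ energyCone κ := by
  have h := add_mem_radonCone hμ.1 hν.1
  refine ⟨h, ?_⟩
  unfold energy
  rw [mutualEnergy_add_left hκ h, mutualEnergy_comm hκ hμ.1 h, mutualEnergy_comm hκ hν.1 h,
    mutualEnergy_add_left hκ hμ.1, mutualEnergy_add_left hκ hν.1]
  simp only [ne_eq, ENNReal.add_eq_top, not_or]
  exact ⟨⟨hμ.2, mutualEnergy_ne_top hE hν hμ⟩, ⟨mutualEnergy_ne_top hE hμ hν, hν.2⟩⟩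

/-- The mutual energy as a real number. -/
noncomputable def energyForm (κ : X → X → ℝ≥0∞) (μ ν : Measure X) : ℝ := (mutualEnergy κ μ ν).toReal

lemma energyForm_nonneg (μ ν : Measure X) : 0 ≤ energyForm κ μ ν := ENNReal.toReal_nonneg

lemma energyForm_comm (hκ : IsKernel κ) {μ ν : Measure X} (hμ : μ ∈ energyCone κ)
    (hν : ν ∈ energyCone κ) : energyForm κ μ ν = energyForm κ ν μ :=
  congrArg _ (mutualEnergy_comm hκ hμ.1 hν.1)

lemma energyForm_add_left (hκ : IsKernel κ) (hE : EnergyPrinciple κ) {μ ν ρ : Measure X}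
    (hμ : μ ∈ energyCone κ) (hν : ν ∈ energyCone κ) (hρ : ρ ∈ energyCone κ) :
    energyForm κ (μ + ν) ρ = energyForm κ μ ρ + energyForm κ ν ρ := by
  unfold energyForm
  rw [mutualEnergy_add_left hκ hρ.1, ENNReal.toReal_add (mutualEnergy_ne_top hE hμ hρ)
    (mutualEnergy_ne_top hE hν hρ)]

lemma energyForm_smul_left (hκ : IsKernel κ) {μ ρ : Measure X}
    (hρ : ρ ∈ energyCone κ) (c : ℝ≥0) :
    energyForm κ (c • μ) ρ = c * energyForm κ μ ρ := by
  unfold energyForm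
  rw [mutualEnergy_smul_left hκ hρ.1, ENNReal.toReal_mul, ENNReal.coe_toReal]

lemma energyForm_add_right (hκ : IsKernel κ) (hE : EnergyPrinciple κ) {μ ν ρ : Measure X}
    (hμ : μ ∈ energyCone κ) (hν : ν ∈ energyCone κ) (hρ : ρ ∈ energyCone κ) :
    energyForm κ ρ (μ + ν) = energyForm κ ρ μ + energyForm κ ρ ν := by
  rw [energyForm_comm hκ hρ (add_mem_energyCone hκ hE hμ hν), energyForm_add_left hκ hE hμ hν hρ,
    energyForm_comm hκ hρ hμ, energyForm_comm hκ hρ hν]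

lemma energyForm_smul_right (hκ : IsKernel κ) {μ ρ : Measure X} (hμ : μ ∈ energyCone κ)
    (hρ : ρ ∈ energyCone κ) (c : ℝ≥0) :
    energyForm κ ρ (c • μ) = c * energyForm κ ρ μ := by
  rw [energyForm_comm hκ hρ (smul_mem_energyCone hκ hμ c), energyForm_smul_left hκ hρ,
    energyForm_comm hκ hρ hμ]

lemma energyForm_add_self (hκ : IsKernel κ) (hE : EnergyPrinciple κ) {μ ν : Measure X}
    (hμ : μ ∈ energyCone κ) (hν : ν ∈ energyCone κ) :
    energyForm κ (μ + ν) (μ + ν) =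
      energyForm κ μ μ + 2 * energyForm κ μ ν + energyForm κ ν ν := by
  rw [energyForm_add_left hκ hE hμ hν (add_mem_energyCone hκ hE hμ hν),
    energyForm_add_right hκ hE hμ hν hμ, energyForm_add_right hκ hE hμ hν hν,
    energyForm_comm hκ hν hμ]
  ring

lemma energyForm_smul_self (hκ : IsKernel κ) {μ : Measure X} (hμ : μ ∈ energyCone κ) (c : ℝ≥0) :
    energyForm κ (c • μ) (c • μ) = c ^ 2 * energyForm κ μ μ := by
  rw [energyForm_smul_left hκ (smul_mem_energyCone hκ hμ c), energyForm_smul_right hκ hμ hμ]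
  ring

lemma two_mul_energyForm_le (hE : EnergyPrinciple κ) {μ ν : Measure X}
    (hμ : μ ∈ energyCone κ) (hν : ν ∈ energyCone κ) :
    2 * energyForm κ μ ν ≤ energyForm κ μ μ + energyForm κ ν ν := by
  have h := ENNReal.toReal_mono (ENNReal.add_ne_top.2 ⟨hμ.2, hν.2⟩) (hE μ hμ ν hν).1
  rw [ENNReal.toReal_mul, ENNReal.toReal_add hμ.2 hν.2] at h
  simpa [energyForm, energy] using h

lemma strongDist_sq (hE : EnergyPrinciple κ) {μ ν : Measure X}
    (hμ : μ ∈ energyCone κ) (hν : ν ∈ energyCone κ) :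
    strongDist κ μ ν ^ 2 = energyForm κ μ μ + energyForm κ ν ν - 2 * energyForm κ μ ν := by
  have := two_mul_energyForm_le hE hμ hν
  exact Real.sq_sqrt (by unfold energyForm at this; unfold energy; linarith)

lemma strongDist_nonneg (μ ν : Measure X) : 0 ≤ strongDist κ μ ν := Real.sqrt_nonneg _

/-- The form in which strictness of the energy principle is used: the opposite of its inequality
forces equality. -/
lemma eq_of_energyForm_le (hE : EnergyPrinciple κ) {μ ν : Measure X}
    (hμ : μ ∈ energyCone κ) (hν : ν ∈ energyCone κ)
    (h : energyForm κ μ μ + energyForm κ ν ν ≤ 2 * energyForm κ μ ν) : μ = ν := by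
  refine (hE μ hμ ν hν).2 ?_
  have h1 := le_antisymm (two_mul_energyForm_le hE hμ hν) h
  have hm := mutualEnergy_ne_top hE hμ hν
  rw [← ENNReal.toReal_eq_toReal_iff' (ENNReal.mul_ne_top (by simp) hm)
    (ENNReal.add_ne_top.2 ⟨hμ.2, hν.2⟩), ENNReal.toReal_mul, ENNReal.toReal_add hμ.2 hν.2]
  simpa [energyForm, energy] using h1

lemma strongDist_comm (hκ : IsKernel κ) {μ ν : Measure X} (hμ : μ ∈ energyCone κ)
    (hν : ν ∈ energyCone κ) : strongDist κ μ ν = strongDist κ ν μ := by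
  unfold strongDist
  rw [mutualEnergy_comm hκ hμ.1 hν.1, add_comm (energy κ μ).toReal]

/-- The Cauchy–Schwarz inequality `|I(ρ, μ - ν)| ≤ ‖ρ‖ ‖μ - ν‖`. -/
lemma abs_energyForm_sub_le (hκ : IsKernel κ) (hE : EnergyPrinciple κ) {μ ν ρ : Measure X}
    (hμ : μ ∈ energyCone κ) (hν : ν ∈ energyCone κ) (hρ : ρ ∈ energyCone κ) :
    |energyForm κ ρ μ - energyForm κ ρ ν| ≤
      √(energyForm κ ρ ρ) * strongDist κ μ ν := by
  have key : ∀ (t : ℝ≥0) {μ ν : Measure X}, μ ∈ energyCone κ → ν ∈ energyCone κ →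
      0 ≤ energyForm κ ρ ρ * (t * t) + (2 * (energyForm κ ρ μ - energyForm κ ρ ν)) * t
        + (energyForm κ μ μ + energyForm κ ν ν - 2 * energyForm κ μ ν) := by
    intro t μ ν hμ hν
    have htρ := smul_mem_energyCone hκ hρ t
    have h := two_mul_energyForm_le hE (add_mem_energyCone hκ hE htρ hμ) hν
    rw [energyForm_add_self hκ hE htρ hμ, energyForm_add_left hκ hE htρ hμ hν,
      energyForm_smul_self hκ hρ, energyForm_smul_left hκ hμ, energyForm_smul_left hκ hν] at h
    linarith
  have hd := discrim_le_zero (a := energyForm κ ρ ρ)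
    (b := 2 * (energyForm κ ρ μ - energyForm κ ρ ν))
    (c := energyForm κ μ μ + energyForm κ ν ν - 2 * energyForm κ μ ν) (by
      intro x
      rcases le_total 0 x with hx | hx
      · lift x to ℝ≥0 using hx
        exact key x hμ hν
      · obtain ⟨t, rfl⟩ : ∃ t : ℝ≥0, x = -t :=
          ⟨(-x).toNNReal, by rw [Real.coe_toNNReal _ (by linarith)]; ring⟩
        have := key t hν hμ
        rw [energyForm_comm hκ hν hμ] at this
        linarith)
  rw [← strongDist_sq hE hμ hν, discrim] at hd
  refine abs_le_of_sq_le_sq ?_ (by have := strongDist_nonneg (κ := κ) μ ν; positivity)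
  rw [mul_pow, Real.sq_sqrt (energyForm_nonneg _ _)]
  linarith

lemma tendsto_energyForm_left (hκ : IsKernel κ) (hE : EnergyPrinciple κ) {μ : ℕ → Measure X}
    {ν ρ : Measure X} (hμ : ∀ n, μ n ∈ energyCone κ) (hν : ν ∈ energyCone κ)
    (hρ : ρ ∈ energyCone κ) (h : StrongTendsto κ μ ν) :
    Tendsto (fun n => energyForm κ ρ (μ n)) atTop (𝓝 (energyForm κ ρ ν)) := by
  rw [tendsto_iff_dist_tendsto_zero]
  refine squeeze_zero (fun _ => dist_nonneg)
    (fun n => abs_energyForm_sub_le hκ hE (hμ n) hν hρ) ?_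
  simpa using Tendsto.const_mul (√(energyForm κ ρ ρ)) h

/-- Follows from ‖μₙ‖² = ‖μₙ - ν‖² - ‖ν‖² + 2 I(ν, μₙ). -/
lemma tendsto_energyForm_self (hκ : IsKernel κ) (hE : EnergyPrinciple κ) {μ : ℕ → Measure X}
    {ν : Measure X} (hμ : ∀ n, μ n ∈ energyCone κ) (hν : ν ∈ energyCone κ)
    (h : StrongTendsto κ μ ν) :
    Tendsto (fun n => energyForm κ (μ n) (μ n)) atTop (𝓝 (energyForm κ ν ν)) := by
  have h1 := ((Tendsto.pow h 2).sub_const (energyForm κ ν ν)).add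
    ((tendsto_energyForm_left hκ hE hμ hν hν h).const_mul 2)
  have e : (0 : ℝ) ^ 2 - energyForm κ ν ν + 2 * energyForm κ ν ν = energyForm κ ν ν := by ring
  rw [e] at h1
  refine h1.congr fun n => ?_
  rw [strongDist_sq hE (hμ n) hν, energyForm_comm hκ hν (hμ n)]
  ring

lemma StrongTendsto.vagueTendsto (hC : ConsistencyPrinciple κ) {μ : ℕ → Measure X}
    {ν : Measure X} (hμ : ∀ n, μ n ∈ energyCone κ) (hν : ν ∈ energyCone κ)
    (h : StrongTendsto κ μ ν) : VagueTendsto μ ν := by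
  intro φ
  rw [Metric.tendsto_atTop]
  intro ε hε
  obtain ⟨δ, hδ, hδε⟩ := hC.strong_finer_vague ν hν φ ε hε
  obtain ⟨N, hN⟩ := (Filter.eventually_atTop.1 (Tendsto.eventually_lt_const hδ h))
  exact ⟨N, fun n hn => hδε _ (hμ n) (hN n hn)⟩

end EnergyForm

/-! ### Capacity estimates, n.e. statements, and strong closedness of 𝓔⁺(A). -/

section Capacity

variable {X : Type*} [TopologicalSpace X] [T2Space X] [LocallyCompactSpace X]
  [SecondCountableTopology X] [MeasurableSpace X] [BorelSpace X] {κ : X → X → ℝ≥0∞}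

lemma energyForm_zero_left (hκ : IsKernel κ) {μ : Measure X} (hμ : μ ∈ energyCone κ) :
    energyForm κ 0 μ = 0 := by
  simp [energyForm, mutualEnergy_eq_lintegral hκ hμ.1]

lemma energyForm_zero_right (hκ : IsKernel κ) {μ : Measure X} (hμ : μ ∈ energyCone κ) :
    energyForm κ μ 0 = 0 := by
  rw [energyForm_comm hκ hμ zero_mem_energyCone, energyForm_zero_left hκ hμ]

lemma eq_zero_of_energy_eq_zero (hκ : IsKernel κ) (hE : EnergyPrinciple κ) {μ : Measure X}
    (hμ : μ ∈ energyCone κ) (h : energy κ μ = 0) : μ = 0 := by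
  refine eq_of_energyForm_le hE hμ zero_mem_energyCone ?_
  rw [energyForm_zero_left hκ zero_mem_energyCone, energyForm_zero_right hκ hμ]
  have : energyForm κ μ μ = 0 := by
    unfold energyForm
    rw [← energy, h, ENNReal.toReal_zero]
  simp [this]

lemma restrict_mem_energyCone (hκ : IsKernel κ) {μ : Measure X} (hμ : μ ∈ energyCone κ)
    (s : Set X) : μ.restrict s ∈ energyCone κ :=
  mem_energyCone_of_le hκ hμ Measure.restrict_le_self

lemma energyConeOn_mono {A B : Set X} (h : A ⊆ B) : energyConeOn κ A ⊆ energyConeOn κ B :=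
  fun _ hμ => ⟨hμ.1, measure_mono_null (compl_subset_compl.2 h) hμ.2⟩

lemma mem_energyConeOn_of_le (hκ : IsKernel κ) {A : Set X} {μ ν : Measure X}
    (hμ : μ ∈ energyConeOn κ A) (h : ν ≤ μ) : ν ∈ energyConeOn κ A :=
  ⟨mem_energyCone_of_le hκ hμ.1 h, le_antisymm ((h _).trans_eq hμ.2) bot_le⟩

lemma restrict_mem_energyConeOn (hκ : IsKernel κ) {A : Set X} {μ : Measure X}
    (hμ : μ ∈ energyConeOn κ A) (s : Set X) : μ.restrict s ∈ energyConeOn κ A :=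
  mem_energyConeOn_of_le hκ hμ Measure.restrict_le_self

lemma smul_mem_energyConeOn (hκ : IsKernel κ) {A : Set X} {μ : Measure X}
    (hμ : μ ∈ energyConeOn κ A) (c : ℝ≥0) : c • μ ∈ energyConeOn κ A :=
  ⟨smul_mem_energyCone hκ hμ.1 c, by simp [hμ.2]⟩

lemma add_mem_energyConeOn (hκ : IsKernel κ) (hE : EnergyPrinciple κ) {A : Set X}
    {μ ν : Measure X} (hμ : μ ∈ energyConeOn κ A) (hν : ν ∈ energyConeOn κ A) :
    μ + ν ∈ energyConeOn κ A :=
  ⟨add_mem_energyCone hκ hE hμ.1 hν.1, by simp [hμ.2, hν.2]⟩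

lemma zero_mem_energyConeOn {A : Set X} : (0 : Measure X) ∈ energyConeOn κ A :=
  ⟨zero_mem_energyCone, by simp⟩

lemma restrict_mem_energyConeOn_of_measurableSet (hκ : IsKernel κ) {μ : Measure X}
    (hμ : μ ∈ energyCone κ) {s : Set X} (hs : MeasurableSet s) :
    μ.restrict s ∈ energyConeOn κ s :=
  ⟨restrict_mem_energyCone hκ hμ s, by simp [Measure.restrict_apply hs.compl]⟩

/-- The normalization of a measure of finite energy and finite nonzero mass. -/
lemma exists_unit_smul (hκ : IsKernel κ) {A : Set X} {μ : Measure X}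
    (hμ : μ ∈ energyConeOn κ A) (h0 : μ univ ≠ 0) (h1 : μ univ ≠ ∞) :
    ∃ ν ∈ energyConeOn κ A, ν univ = 1 ∧ μ univ ^ 2 * energy κ ν = energy κ μ := by
  obtain ⟨m, hm⟩ : ∃ m : ℝ≥0, μ univ = m := ⟨_, (ENNReal.coe_toNNReal h1).symm⟩
  have hm0 : m ≠ 0 := by rintro rfl; exact h0 (by simpa using hm)
  refine ⟨m⁻¹ • μ, smul_mem_energyConeOn hκ hμ _, ?_, ?_⟩
  · rw [Measure.smul_apply, hm, ENNReal.smul_def, smul_eq_mul, ← ENNReal.coe_mul,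
      inv_mul_cancel₀ hm0, ENNReal.coe_one]
  · rw [energy_smul hκ hμ.1.1, hm, ← mul_assoc, ← ENNReal.coe_pow, ← ENNReal.coe_pow,
      ← ENNReal.coe_mul, ← mul_pow, mul_inv_cancel₀ hm0, one_pow, ENNReal.coe_one, one_mul]

/-- The normalized restriction of μ to K competes in w(K), and restriction does not increase energy.
-/
lemma sq_measure_le_of_isCompact (hκ : IsKernel κ) (hE : EnergyPrinciple κ) {μ : Measure X}
    (hμ : μ ∈ energyCone κ) {K : Set X} (hK : IsCompact K) :
    μ K ^ 2 ≤ energy κ μ * (wiener κ K)⁻¹ := by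
  have : IsFiniteMeasureOnCompacts μ := hμ.1
  rcases eq_or_ne (μ K) 0 with h0 | h0
  · simp [h0]
  obtain ⟨ν, hν, hν1, hν2⟩ := exists_unit_smul hκ
    (restrict_mem_energyConeOn_of_measurableSet hκ hμ hK.measurableSet)
    (by simpa using h0) (by simpa using hK.measure_lt_top.ne)
  have hw : wiener κ K ≤ energy κ ν := iInf₂_le ν ⟨hν.1.1, hν.2, hν1⟩
  have h1 : μ K ^ 2 * wiener κ K ≤ energy κ μ := by
    rw [Measure.restrict_apply_univ] at hν2
    calc _ ≤ μ K ^ 2 * energy κ ν := by gcongr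
      _ ≤ _ := hν2.trans_le (energy_mono hκ hμ.1 Measure.restrict_le_self)
  rw [← div_eq_mul_inv]
  -- Since w(K) may be 0 or ∞, the division needs 0 < I(μ) < ∞; the energy principle excludes I(μ) =
  -- 0 when μ(K) ≠ 0.
  refine (ENNReal.le_div_iff_mul_le (Or.inr fun h => h0 ?_) (Or.inr hμ.2)).2 h1
  simp [eq_zero_of_energy_eq_zero hκ hE hμ h]

/-- A measure concentrated on `B` is carried by the compact subsets of `B`. -/
lemma exists_isCompact_lt {μ : Measure X} (hμ : μ ∈ radonCone X) {B : Set X} (hB : μ Bᶜ = 0)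
    {r : ℝ≥0∞} (hr : r < μ univ) : ∃ K ⊆ B, IsCompact K ∧ r < μ K := by
  have : IsFiniteMeasureOnCompacts μ := hμ
  -- As B need not be measurable, it is replaced by a measurable subset of full measure.
  have h1 : μ univ = μ (toMeasurable μ Bᶜ)ᶜ := by
    rw [← measure_add_measure_compl (measurableSet_toMeasurable μ Bᶜ), measure_toMeasurable, hB,
      zero_add]
  obtain ⟨K, hK, hKc, hKr⟩ :=
    (measurableSet_toMeasurable μ Bᶜ).compl.exists_lt_isCompact (h1 ▸ hr)
  exact ⟨K, hK.trans (compl_subset_comm.1 (subset_toMeasurable μ Bᶜ)), hKc, hKr⟩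

/-- The basic capacity estimate, obtained from compact subsets of B by inner regularity; every later
comparison of mass with capacity rests on it. -/
lemma measure_univ_le (hκ : IsKernel κ) (hE : EnergyPrinciple κ) {B : Set X} {μ : Measure X}
    (hμ : μ ∈ energyConeOn κ B) :
    μ univ ≤ (energy κ μ * innerCapacity κ B) ^ (2⁻¹ : ℝ) := by
  refine le_of_forall_lt_imp_le_of_dense fun r hr => ?_
  obtain ⟨K, hKB, hK, hrK⟩ := exists_isCompact_lt hμ.1.1 hμ.2 hr
  rw [ENNReal.le_rpow_inv_iff two_pos, ENNReal.rpow_ofNat]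
  calc r ^ 2 ≤ μ K ^ 2 := by gcongr
    _ ≤ energy κ μ * (wiener κ K)⁻¹ := sq_measure_le_of_isCompact hκ hE hμ.1 hK
    _ ≤ _ := by
      gcongr
      exact le_iSup₂_of_le (f := fun K (_ : K ∈ {K : Set X | IsCompact K ∧ K ⊆ B}) =>
        (wiener κ K)⁻¹) K ⟨hK, hKB⟩ le_rfl

lemma measure_le_of_measurableSet (hκ : IsKernel κ) (hE : EnergyPrinciple κ) {B : Set X}
    {μ : Measure X} (hμ : μ ∈ energyCone κ) (hB : MeasurableSet B) :
    μ B ≤ (energy κ μ * innerCapacity κ B) ^ (2⁻¹ : ℝ) := by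
  have h := measure_univ_le hκ hE (restrict_mem_energyConeOn_of_measurableSet hκ hμ hB)
  rw [Measure.restrict_apply_univ] at h
  refine h.trans ?_
  gcongr
  exact energy_mono hκ hμ.1 Measure.restrict_le_self

lemma innerCapacity_mono {A B : Set X} (h : A ⊆ B) : innerCapacity κ A ≤ innerCapacity κ B :=
  iSup₂_le fun K hK => le_iSup₂_of_le (f := fun K (_ : K ∈ {K : Set X | IsCompact K ∧ K ⊆ B}) =>
        (wiener κ K)⁻¹) K ⟨hK.1, hK.2.trans h⟩ le_rfl

lemma exists_unit_of_wiener_ne_top {K : Set X} (h : wiener κ K ≠ ∞) :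
    ∃ μ ∈ energyConeOn κ K, μ univ = 1 := by
  by_contra! hcon
  refine h (iInf₂_eq_top.2 fun μ hμ => ?_)
  by_contra hfin
  exact hcon μ ⟨⟨hμ.1, hfin⟩, hμ.2.1⟩ hμ.2.2

lemma exists_unit_of_innerCapacity_pos {A : Set X} (h : 0 < innerCapacity κ A) :
    ∃ μ ∈ energyConeOn κ A, μ univ = 1 := by
  simp only [innerCapacity, lt_iSup_iff, exists_prop] at h
  obtain ⟨K, hK, h1⟩ := h
  obtain ⟨μ, hμ, hμ1⟩ := exists_unit_of_wiener_ne_top (κ := κ) (K := K)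
    (fun h => by simp [h] at h1)
  exact ⟨μ, energyConeOn_mono hK.2 hμ, hμ1⟩

/-- A compact part of the exceptional set with positive capacity would carry a unit measure of
finite energy, and almost all of its points would satisfy `P`. -/
lemma nearlyEverywhereOn_of_isCompact {A : Set X} {P : X → Prop}
    (h : ∀ K ⊆ A, IsCompact K → ∀ μ ∈ energyConeOn κ K, ∀ᵐ x ∂μ, P x) :
    NearlyEverywhereOn κ A P := by
  refine le_antisymm (iSup₂_le fun K hK => ?_) bot_le
  by_contra hcon
  obtain ⟨μ, hμ, hμ1⟩ := exists_unit_of_wiener_ne_top (κ := κ) (K := K)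
    (fun h => hcon (by simp [h]))
  have h1 := h K (fun x hx => (hK.2 hx).1) hK.1 μ hμ
  have h2 : ∀ᵐ x ∂μ, x ∈ K := hμ.2
  have h3 : ∀ᵐ x ∂μ, False := by
    filter_upwards [h1, h2] with x hx hxK using (hK.2 hxK).2 hx
  rw [ae_iff] at h3
  simp [hμ1] at h3

/-- Replaces capacity by almost everywhere statements: the part of μ on the exceptional set has zero
mass by the capacity estimate. -/
lemma nearlyEverywhereOn_iff (hκ : IsKernel κ) (hE : EnergyPrinciple κ) {A : Set X}
    {P : X → Prop} (hP : MeasurableSet {x | P x}) :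
    NearlyEverywhereOn κ A P ↔ ∀ μ ∈ energyConeOn κ A, ∀ᵐ x ∂μ, P x := by
  constructor
  · intro h μ hμ
    have hν : μ.restrict {x | P x}ᶜ ∈ energyConeOn κ {x ∈ A | ¬ P x} := by
      refine ⟨restrict_mem_energyCone hκ hμ.1 _, ?_⟩
      refine measure_mono_null (t := Aᶜ ∪ {x | P x}) ?_ (measure_union_null ?_ ?_)
      · intro x hx
        by_cases hA : x ∈ A
        · exact Or.inr (by_contra fun hp => hx ⟨hA, hp⟩)
        · exact Or.inl hA
      · exact le_antisymm ((Measure.restrict_le_self _).trans_eq hμ.2) bot_le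
      · simp [Measure.restrict_apply hP]
    have h1 := measure_univ_le hκ hE hν
    rw [h] at h1
    have h2 : μ {x | P x}ᶜ = 0 := by simpa using h1
    exact h2
  · exact fun h => nearlyEverywhereOn_of_isCompact fun K hKA _ μ hμ =>
      h μ (energyConeOn_mono hKA hμ)

lemma measure_le_ofReal_integral {μ : Measure X} (hμ : μ ∈ radonCone X) (φ : C_c(X, ℝ))
    (h0 : ∀ x, 0 ≤ φ x) {K : Set X} (hK : MeasurableSet K) (h1 : ∀ x ∈ K, 1 ≤ φ x) :
    μ K ≤ ENNReal.ofReal (∫ x, φ x ∂μ) := by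
  have : IsFiniteMeasureOnCompacts μ := hμ
  have hi : Integrable (fun x => φ x) μ :=
    φ.continuous.integrable_of_hasCompactSupport φ.hasCompactSupport
  rw [ofReal_integral_eq_lintegral_ofReal hi (ae_of_all _ h0),
    ← lintegral_indicator_one hK]
  refine lintegral_mono fun x => ?_
  by_cases hx : x ∈ K
  · simpa [hx] using h1 x hx
  · simp [hx]

lemma ofReal_integral_le_measure {μ : Measure X} (hμ : μ ∈ radonCone X) (φ : C_c(X, ℝ))
    (h0 : ∀ x, 0 ≤ φ x) {G : Set X} (hG : MeasurableSet G) (h1 : ∀ x, φ x ≤ 1)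
    (h2 : ∀ x, x ∉ G → φ x = 0) :
    ENNReal.ofReal (∫ x, φ x ∂μ) ≤ μ G := by
  have : IsFiniteMeasureOnCompacts μ := hμ
  have hi : Integrable (fun x => φ x) μ :=
    φ.continuous.integrable_of_hasCompactSupport φ.hasCompactSupport
  rw [ofReal_integral_eq_lintegral_ofReal hi (ae_of_all _ h0),
    ← lintegral_indicator_one hG]
  refine lintegral_mono fun x => ?_
  by_cases hx : x ∈ G
  · simpa [hx] using h1 x
  · simp [hx, h2 x hx]

/-- Urysohn functions as compactly supported continuous maps. -/
lemma exists_urysohn {K G : Set X} (hK : IsCompact K) (hG : IsOpen G) (hKG : K ⊆ G) :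
    ∃ φ : C_c(X, ℝ), (∀ x, 0 ≤ φ x) ∧ (∀ x, φ x ≤ 1) ∧ (∀ x ∈ K, φ x = 1) ∧
      ∀ x, x ∉ G → φ x = 0 := by
  obtain ⟨f, hf1, hf2, hf3, hf4⟩ := exists_continuousMap_one_of_isCompact_subset_isOpen hK hG hKG
  exact ⟨⟨f, hf2⟩, fun x => (hf4 x).1, fun x => (hf4 x).2, fun x hx => hf1 hx,
    fun x hx => image_eq_zero_of_notMem_tsupport fun h => hx (hf3 h)⟩

/-- Lower semicontinuity of mass on open sets, by testing with functions that are 1 on a compact set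
and vanish off G. -/
lemma VagueTendsto.measure_le_of_isOpen {μ : ℕ → Measure X} {ν : Measure X}
    (h : VagueTendsto μ ν) (hμ : ∀ n, μ n ∈ radonCone X) (hν : ν ∈ radonCone X) {G : Set X}
    (hG : IsOpen G) {c : ℝ≥0∞} (hc : ∀ n, μ n G ≤ c) : ν G ≤ c := by
  have : IsFiniteMeasureOnCompacts ν := hν
  refine le_of_forall_lt_imp_le_of_dense fun r hr => ?_
  obtain ⟨K, hKG, hK, hrK⟩ := hG.measurableSet.exists_lt_isCompact hr
  obtain ⟨φ, h0, h1, h2, h3⟩ := exists_urysohn hK hG hKG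
  refine hrK.le.trans ((measure_le_ofReal_integral hν φ h0 hK.measurableSet
    fun x hx => (h2 x hx).ge).trans ?_)
  exact le_of_tendsto' ((ENNReal.continuous_ofReal.tendsto _).comp (h φ)) fun n =>
    (ofReal_integral_le_measure (hμ n) φ h0 hG.measurableSet h1 h3).trans (hc n)

/-- A set of measures of finite energy is strongly closed. -/
def IsStronglyClosed (κ : X → X → ℝ≥0∞) (S : Set (Measure X)) : Prop :=
  ∀ (μ : ℕ → Measure X) (ν : Measure X), (∀ n, μ n ∈ S) → ν ∈ energyCone κ →
    StrongTendsto κ μ ν → ν ∈ S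

lemma isStronglyClosed_energyConeOn_of_isClosed (hC : ConsistencyPrinciple κ) {F : Set X}
    (hF : IsClosed F) : IsStronglyClosed κ (energyConeOn κ F) := fun _ _ hμ hν h =>
  ⟨hν, le_antisymm ((h.vagueTendsto hC (fun n => (hμ n).1) hν).measure_le_of_isOpen
    (fun n => (hμ n).1.1) hν.1 hF.isOpen_compl fun n => (hμ n).2.le) bot_le⟩

lemma StrongTendsto.exists_energy_le (hκ : IsKernel κ) (hE : EnergyPrinciple κ)
    {μ : ℕ → Measure X} {ν : Measure X} (hμ : ∀ n, μ n ∈ energyCone κ) (hν : ν ∈ energyCone κ)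
    (h : StrongTendsto κ μ ν) : ∃ R : ℝ≥0, (∀ n, energy κ (μ n) ≤ R) ∧ energy κ ν ≤ R := by
  have h1 := tendsto_energyForm_self hκ hE hμ hν h
  obtain ⟨R, hR⟩ := h1.bddAbove_range
  have hR' : ∀ n, energyForm κ (μ n) (μ n) ≤ R := fun n => hR ⟨n, rfl⟩
  have key : ∀ ρ ∈ energyCone κ, energyForm κ ρ ρ ≤ R → energy κ ρ ≤ (R.toNNReal : ℝ≥0∞) :=
    fun ρ hρ hle => by
      rw [← ENNReal.ofReal_toReal hρ.2]
      exact ENNReal.ofReal_le_ofReal hle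
  exact ⟨R.toNNReal, fun n => key _ (hμ n) (hR' n), key _ hν (le_of_tendsto' h1 hR')⟩

/-- Choose F closed and G ⊇ A ∆ F open of capacity below ε. Measures of energy at most R have mass
at most √(Rε) on G. The approximating measures therefore satisfy this bound on the open set Fᶜ, so
the limit does too, and Aᶜ ⊆ Fᶜ ∪ G. -/
lemma isStronglyClosed_energyConeOn_of_isQuasiclosed (hκ : IsKernel κ) (hE : EnergyPrinciple κ)
    (hC : ConsistencyPrinciple κ) {A : Set X} (hA : IsQuasiclosed κ A) :
    IsStronglyClosed κ (energyConeOn κ A) := by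
  intro μ ν hμ hν h
  refine ⟨hν, ?_⟩
  obtain ⟨R, hR, hR'⟩ := h.exists_energy_le hκ hE (fun n => (hμ n).1) hν
  have key : ∀ ε : ℝ≥0∞, 0 < ε → ν Aᶜ ≤ 2 * (R * ε) ^ (2⁻¹ : ℝ) := by
    intro ε hε
    have hlt := hA.trans_lt hε
    simp only [outerCapacity, iInf_lt_iff, exists_prop] at hlt
    obtain ⟨F, hF, G, ⟨hG, hGF⟩, hGε⟩ := hlt
    have hF : IsClosed F := hF
    have hcap : ∀ ρ ∈ energyCone κ, energy κ ρ ≤ R → ρ G ≤ (R * ε) ^ (2⁻¹ : ℝ) :=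
      fun ρ hρ hle => (measure_le_of_measurableSet hκ hE hρ hG.measurableSet).trans (by gcongr)
    have h1 : ν Fᶜ ≤ (R * ε) ^ (2⁻¹ : ℝ) := by
      refine (h.vagueTendsto hC (fun n => (hμ n).1) hν).measure_le_of_isOpen
        (fun n => (hμ n).1.1) hν.1 hF.isOpen_compl fun n => ?_
      have hsub : Fᶜ ⊆ Aᶜ ∪ G := fun x hx => by
        by_cases hxA : x ∈ A
        · exact Or.inr (hGF (Or.inl ⟨hxA, hx⟩))
        · exact Or.inl hxA
      refine (measure_mono hsub).trans ((measure_union_le _ _).trans ?_)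
      rw [(hμ n).2, zero_add]
      exact hcap _ (hμ n).1 (hR n)
    have hsub : Aᶜ ⊆ Fᶜ ∪ G := fun x hx => by
      by_cases hxF : x ∈ F
      · exact Or.inr (hGF (Or.inr ⟨hxF, hx⟩))
      · exact Or.inl hxF
    refine (measure_mono hsub).trans ((measure_union_le _ _).trans ?_)
    rw [two_mul]
    exact add_le_add h1 (hcap _ hν hR')
  have hlim : Tendsto (fun ε : ℝ≥0∞ => 2 * (R * ε) ^ (2⁻¹ : ℝ)) (𝓝[>] 0) (𝓝 0) := by
    have h1 : Tendsto (fun ε : ℝ≥0∞ => (R : ℝ≥0∞) * ε) (𝓝 0) (𝓝 0) := by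
      simpa using ENNReal.Tendsto.const_mul (a := (R : ℝ≥0∞)) (tendsto_id (x := 𝓝 (0 : ℝ≥0∞)))
        (Or.inr ENNReal.coe_ne_top)
    have h2 := ENNReal.Tendsto.const_mul (a := 2) (h1.ennrpow_const (2⁻¹ : ℝ))
      (Or.inr ENNReal.ofNat_ne_top)
    rw [ENNReal.zero_rpow_of_pos (by norm_num), mul_zero] at h2
    exact h2.mono_left nhdsWithin_le_nhds
  exact le_antisymm (ge_of_tendsto hlim (by
    filter_upwards [self_mem_nhdsWithin] with ε hε using key ε hε)) bot_le

end Capacity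

/-! ### Minimization of strictly convex functionals over convex sets of measures. -/

section Minimization

variable {X : Type*} [TopologicalSpace X] [T2Space X] [LocallyCompactSpace X]
  [SecondCountableTopology X] [MeasurableSpace X] [BorelSpace X] {κ : X → X → ℝ≥0∞}

/-- The functional `I(μ) - 2 L(μ)`. -/
noncomputable def quadraticFunctional (κ : X → X → ℝ≥0∞) (L : Measure X → ℝ) (μ : Measure X) : ℝ :=
  energyForm κ μ μ - 2 * L μ

/-- `S` is closed under midpoints. -/
def IsMidpointConvex (S : Set (Measure X)) : Prop :=
  ∀ μ ∈ S, ∀ ν ∈ S, (2⁻¹ : ℝ≥0) • (μ + ν) ∈ S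

/-- `L` is compatible with midpoints of elements of `S`. -/
def IsMidpointAffineOn (L : Measure X → ℝ) (S : Set (Measure X)) : Prop :=
  ∀ μ ∈ S, ∀ ν ∈ S, L ((2⁻¹ : ℝ≥0) • (μ + ν)) = (L μ + L ν) / 2

/-- `L` is sequentially continuous on `S` with respect to the strong topology. -/
def IsStronglyContinuousOn (κ : X → X → ℝ≥0∞) (L : Measure X → ℝ) (S : Set (Measure X)) : Prop :=
  ∀ (μ : ℕ → Measure X) (ν : Measure X), (∀ n, μ n ∈ S) → ν ∈ S → StrongTendsto κ μ ν →
    Tendsto (fun n => L (μ n)) atTop (𝓝 (L ν))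

lemma IsStronglyContinuousOn.mono {L : Measure X → ℝ} {S T : Set (Measure X)} (hTS : T ⊆ S)
    (h : IsStronglyContinuousOn κ L S) : IsStronglyContinuousOn κ L T :=
  fun μ ν hμ hν => h μ ν (fun n => hTS (hμ n)) (hTS hν)

lemma IsMidpointAffineOn.mono {L : Measure X → ℝ} {S T : Set (Measure X)} (hTS : T ⊆ S)
    (h : IsMidpointAffineOn L S) : IsMidpointAffineOn L T :=
  fun μ hμ ν hν => h μ (hTS hμ) ν (hTS hν)

/-- The parallelogram identity; the contributions of `L` cancel. -/
lemma strongDist_sq_eq_midpoint (hκ : IsKernel κ) (hE : EnergyPrinciple κ) {μ ν : Measure X}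
    (hμ : μ ∈ energyCone κ) (hν : ν ∈ energyCone κ) {L : Measure X → ℝ}
    (hL : L ((2⁻¹ : ℝ≥0) • (μ + ν)) = (L μ + L ν) / 2) :
    strongDist κ μ ν ^ 2 = 2 * quadraticFunctional κ L μ + 2 * quadraticFunctional κ L ν -
      4 * quadraticFunctional κ L ((2⁻¹ : ℝ≥0) • (μ + ν)) := by
  unfold quadraticFunctional
  rw [strongDist_sq hE hμ hν, hL, energyForm_smul_self hκ (add_mem_energyCone hκ hE hμ hν),
    energyForm_add_self hκ hE hμ hν]
  push_cast
  ring

lemma tendsto_quadraticFunctional (hκ : IsKernel κ) (hE : EnergyPrinciple κ) {μ : ℕ → Measure X}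
    {ν : Measure X} {L : Measure X → ℝ} {S : Set (Measure X)} (hS : S ⊆ energyCone κ)
    (hL : IsStronglyContinuousOn κ L S) (hμ : ∀ n, μ n ∈ S) (hν : ν ∈ S)
    (h : StrongTendsto κ μ ν) : Tendsto (fun n => quadraticFunctional κ L (μ n)) atTop
      (𝓝 (quadraticFunctional κ L ν)) :=
  (tendsto_energyForm_self hκ hE (fun n => hS (hμ n)) (hS hν) h).sub
    ((hL μ ν hμ hν h).const_mul 2)

/-- Almost minimizers over a decreasing sequence of convex sets converge strongly. -/
theorem exists_strongTendsto_of_almost_minimizers (hκ : IsKernel κ) (hE : EnergyPrinciple κ)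
    (hC : ConsistencyPrinciple κ) {S : ℕ → Set (Measure X)} (hSE : S 0 ⊆ energyCone κ)
    (hanti : Antitone S) (hmid : ∀ j, IsMidpointConvex (S j)) {L : Measure X → ℝ}
    (hL : IsMidpointAffineOn L (S 0)) {b B : ℝ}
    (hb : ∀ μ ∈ S 0, b ≤ quadraticFunctional κ L μ) {μ : ℕ → Measure X} (hμ : ∀ j, μ j ∈ S j)
    {ε : ℕ → ℝ} (hε : Tendsto ε atTop (𝓝 0))
    (hmin : ∀ j, ∀ ν ∈ S j, quadraticFunctional κ L (μ j) ≤ quadraticFunctional κ L ν + ε j)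
    (hB : ∀ j, quadraticFunctional κ L (μ j) ≤ B) :
    ∃ ν ∈ energyCone κ, StrongTendsto κ μ ν := by
  set J := quadraticFunctional κ L
  have hS0 : ∀ j, S j ⊆ S 0 := fun j => hanti (Nat.zero_le j)
  have hbdd : ∀ j, BddBelow (J '' S j) := fun j =>
    ⟨b, by rintro _ ⟨ν, hν, rfl⟩; exact hb ν (hS0 j hν)⟩
  set i : ℕ → ℝ := fun j => sInf (J '' S j)
  have hile : ∀ j, ∀ ν ∈ S j, i j ≤ J ν := fun j ν hν => csInf_le (hbdd j) ⟨ν, hν, rfl⟩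
  have himono : Monotone i := fun j k hjk =>
    csInf_le_csInf (hbdd j) ⟨_, μ k, hμ k, rfl⟩ (image_mono (hanti hjk))
  have hibdd : BddAbove (range i) :=
    ⟨B, by rintro _ ⟨j, rfl⟩; exact (hile j _ (hμ j)).trans (hB j)⟩
  have hJi : ∀ j, J (μ j) ≤ i j + ε j := fun j => by
    have : J (μ j) - ε j ≤ i j := le_csInf ⟨_, μ j, hμ j, rfl⟩ (by
      rintro _ ⟨ν, hν, rfl⟩
      linarith [hmin j ν hν])
    linarith
  have hilim := tendsto_atTop_ciSup himono hibdd
  have hisup : ∀ j, i j ≤ ⨆ j, i j := fun j => le_ciSup hibdd j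
  set e : ℕ → ℝ := fun j => 2 * ε j + 2 * ((⨆ j, i j) - i j)
  have he : Tendsto e atTop (𝓝 0) := by
    simpa using (hε.const_mul 2).add ((hilim.const_sub (⨆ j, i j)).const_mul 2)
  have hμE : ∀ j, μ j ∈ energyCone κ := fun j => hSE (hS0 j (hμ j))
  -- The midpoint of μ_j and μ_k lies in the larger set `S j`, so its value is at least `i j`. The
  -- infima increase to a finite supremum, so `e` tends to 0.
  have hle : ∀ j k, j ≤ k → strongDist κ (μ j) (μ k) ^ 2 ≤ e j + e k := by
    intro j k hjk
    have hk := hanti hjk (hμ k)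
    rw [strongDist_sq_eq_midpoint hκ hE (hμE j) (hμE k)
      (hL _ (hS0 j (hμ j)) _ (hS0 j hk))]
    have h1 := hile j _ (hmid j _ (hμ j) _ hk)
    have h2 := hJi j
    have h3 := hJi k
    have h4 := hisup k
    simp only [e, J] at *
    linarith
  have hle' : ∀ j k, strongDist κ (μ j) (μ k) ^ 2 ≤ e j + e k := by
    intro j k
    rcases le_total j k with h | h
    · exact hle j k h
    · rw [strongDist_comm hκ (hμE j) (hμE k), add_comm]
      exact hle k j h
  refine hC.complete μ hμE fun δ hδ => ?_
  obtain ⟨N, hN⟩ := eventually_atTop.1 (he.eventually_lt_const (show 0 < δ ^ 2 / 2 by positivity))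
  refine ⟨N, fun j hj k hk => lt_of_pow_lt_pow_left₀ 2 hδ.le ?_⟩
  linarith [hle' j k, hN j hj, hN k hk]

lemma exists_almost_minimizer {S : Set (Measure X)} {J : Measure X → ℝ} {b : ℝ}
    (hb : ∀ μ ∈ S, b ≤ J μ) (hne : S.Nonempty) {ε : ℝ} (hε : 0 < ε) :
    ∃ μ ∈ S, ∀ ν ∈ S, J μ ≤ J ν + ε := by
  have hbdd : BddBelow (J '' S) := ⟨b, by rintro _ ⟨ν, hν, rfl⟩; exact hb ν hν⟩
  obtain ⟨_, ⟨μ, hμ, rfl⟩, h⟩ := exists_lt_of_csInf_lt (hne.image J)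
    (lt_add_of_pos_right (sInf (J '' S)) hε)
  exact ⟨μ, hμ, fun ν hν => by linarith [csInf_le hbdd ⟨ν, hν, rfl⟩]⟩

/-- The constant sequence of sets, with 1/(n+1)-minimizers: closedness keeps the limit in `S`, and
continuity makes it minimal. -/
theorem exists_minimizer (hκ : IsKernel κ) (hE : EnergyPrinciple κ)
    (hC : ConsistencyPrinciple κ) {S : Set (Measure X)} (hSE : S ⊆ energyCone κ)
    (hmid : IsMidpointConvex S) (hcl : IsStronglyClosed κ S) (hne : S.Nonempty)
    {L : Measure X → ℝ} (hL : IsMidpointAffineOn L S) (hLc : IsStronglyContinuousOn κ L S) {b : ℝ}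
    (hb : ∀ μ ∈ S, b ≤ quadraticFunctional κ L μ) :
    ∃ μ ∈ S, ∀ ν ∈ S, quadraticFunctional κ L μ ≤ quadraticFunctional κ L ν := by
  have hpos : ∀ n : ℕ, (0 : ℝ) < 1 / ((n : ℝ) + 1) := fun n => Nat.one_div_pos_of_nat
  choose μ hμ hmin using fun n : ℕ => exists_almost_minimizer hb hne (hpos n)
  obtain ⟨ρ, hρ⟩ := hne
  have hε := tendsto_one_div_add_atTop_nhds_zero_nat (𝕜 := ℝ)
  obtain ⟨ν, hν, hlim⟩ := exists_strongTendsto_of_almost_minimizers hκ hE hC (S := fun _ => S)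
    hSE antitone_const (fun _ => hmid) hL hb hμ hε hmin
    (B := quadraticFunctional κ L ρ + 1) (fun j => (hmin j ρ hρ).trans (by
      gcongr
      rw [div_le_one (by positivity)]
      have : (0 : ℝ) ≤ j := Nat.cast_nonneg j
      linarith))
  have hνS := hcl μ ν hμ hν hlim
  refine ⟨ν, hνS, fun σ hσ => ?_⟩
  refine le_of_tendsto_of_tendsto' (tendsto_quadraticFunctional hκ hE hSE hLc hμ hνS hlim)
    (by simpa using hε.const_add (quadraticFunctional κ L σ)) fun n => hmin n σ hσ

theorem eq_of_minimizers (hκ : IsKernel κ) (hE : EnergyPrinciple κ) {S : Set (Measure X)}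
    (hSE : S ⊆ energyCone κ) (hmid : IsMidpointConvex S) {L : Measure X → ℝ}
    (hL : IsMidpointAffineOn L S) {μ ν : Measure X} (hμ : μ ∈ S) (hν : ν ∈ S)
    (h1 : ∀ σ ∈ S, quadraticFunctional κ L μ ≤ quadraticFunctional κ L σ)
    (h2 : ∀ σ ∈ S, quadraticFunctional κ L ν ≤ quadraticFunctional κ L σ) : μ = ν := by
  have hm := hmid μ hμ ν hν
  have h := strongDist_sq_eq_midpoint hκ hE (hSE hμ) (hSE hν) (hL μ hμ ν hν)
  rw [strongDist_sq hE (hSE hμ) (hSE hν)] at h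
  refine eq_of_energyForm_le hE (hSE hμ) (hSE hν) ?_
  linarith [h1 _ hm, h2 _ hm]

lemma StrongTendsto.shift {μ : ℕ → Measure X} {ν : Measure X} (h : StrongTendsto κ μ ν) (i : ℕ) :
    StrongTendsto κ (fun n => μ (n + i)) ν :=
  (tendsto_add_atTop_iff_nat (f := fun n => strongDist κ (μ n) ν) i).2 h

/-- Minimizers over a decreasing sequence of strongly closed convex sets converge strongly to the
minimizer over the intersection. -/
theorem strongTendsto_of_minimizers (hκ : IsKernel κ) (hE : EnergyPrinciple κ)
    (hC : ConsistencyPrinciple κ) {S : ℕ → Set (Measure X)} (hSE : S 0 ⊆ energyCone κ)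
    (hanti : Antitone S) (hmid : ∀ j, IsMidpointConvex (S j)) (hcl : ∀ j, IsStronglyClosed κ (S j))
    {L : Measure X → ℝ} (hL : IsMidpointAffineOn L (S 0)) (hLc : IsStronglyContinuousOn κ L (S 0))
    {μ : ℕ → Measure X} (hμ : ∀ j, μ j ∈ S j)
    (hmin : ∀ j, ∀ ν ∈ S j, quadraticFunctional κ L (μ j) ≤ quadraticFunctional κ L ν)
    {l : Measure X} (hl : l ∈ ⋂ j, S j)
    (hlmin : ∀ ν ∈ ⋂ j, S j, quadraticFunctional κ L l ≤ quadraticFunctional κ L ν) :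
    StrongTendsto κ μ l := by
  have hlj := mem_iInter.1 hl
  have hS0 : ∀ j, S j ⊆ S 0 := fun j => hanti (Nat.zero_le j)
  obtain ⟨ν, hν, hlim⟩ := exists_strongTendsto_of_almost_minimizers hκ hE hC hSE hanti hmid hL
    (hmin 0) hμ (tendsto_const_nhds (x := (0 : ℝ))) (by simpa using hmin)
    (fun j => hmin j l (hlj j))
  have hνS : ∀ i, ν ∈ S i := fun i =>
    hcl i _ ν (fun n => hanti (Nat.le_add_left i n) (hμ (n + i))) hν (hlim.shift i)
  -- As `l` competes in each `S j`, the limit does no worse than `l`, hence equals it by uniqueness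
  -- over the intersection.
  have hle : quadraticFunctional κ L ν ≤ quadraticFunctional κ L l :=
    le_of_tendsto' (tendsto_quadraticFunctional hκ hE hSE hLc (fun n => hS0 n (hμ n)) (hνS 0) hlim)
      fun j => hmin j l (hlj j)
  have heq : ν = l := by
    refine eq_of_minimizers hκ hE (S := ⋂ j, S j) ((iInter_subset S 0).trans hSE) ?_
      (hL.mono (iInter_subset S 0)) (mem_iInter.2 hνS) hl (fun σ hσ => hle.trans (hlmin σ hσ)) hlmin
    intro σ hσ τ hτ
    exact mem_iInter.2 fun j => hmid j σ (mem_iInter.1 hσ j) τ (mem_iInter.1 hτ j)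
  exact heq ▸ hlim

end Minimization

/-! ### Representation of continuous functionals by potentials. -/

section Projection

variable {X : Type*} [TopologicalSpace X] [T2Space X] [LocallyCompactSpace X]
  [SecondCountableTopology X] [MeasurableSpace X] [BorelSpace X] {κ : X → X → ℝ≥0∞}

/-- The functional `μ ↦ ∫ g dμ` as a real number. -/
noncomputable def integralFunctional (g : X → ℝ≥0∞) (μ : Measure X) : ℝ := (∫⁻ x, g x ∂μ).toReal

lemma integralFunctional_nonneg (g : X → ℝ≥0∞) (μ : Measure X) : 0 ≤ integralFunctional g μ :=
  ENNReal.toReal_nonneg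

lemma integralFunctional_zero (g : X → ℝ≥0∞) : integralFunctional g 0 = 0 := by
  simp [integralFunctional]

lemma integralFunctional_smul (g : X → ℝ≥0∞) (c : ℝ≥0) (μ : Measure X) :
    integralFunctional g (c • μ) = c * integralFunctional g μ := by
  unfold integralFunctional
  rw [lintegral_smul_measure, ENNReal.smul_def, smul_eq_mul, ENNReal.toReal_mul, ENNReal.coe_toReal]

lemma integralFunctional_add {g : X → ℝ≥0∞} {μ ν : Measure X} (hμ : ∫⁻ x, g x ∂μ ≠ ∞)
    (hν : ∫⁻ x, g x ∂ν ≠ ∞) :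
    integralFunctional g (μ + ν) = integralFunctional g μ + integralFunctional g ν := by
  simp [integralFunctional, lintegral_add_measure, ENNReal.toReal_add hμ hν]

lemma isMidpointConvex_energyConeOn (hκ : IsKernel κ) (hE : EnergyPrinciple κ) (A : Set X) :
    IsMidpointConvex (energyConeOn κ A) := fun _ hμ _ hν =>
  smul_mem_energyConeOn hκ (add_mem_energyConeOn hκ hE hμ hν) _

lemma isMidpointAffineOn_integralFunctional {S : Set (Measure X)} {g : X → ℝ≥0∞}
    (hg : ∀ μ ∈ S, ∫⁻ x, g x ∂μ ≠ ∞) : IsMidpointAffineOn (integralFunctional g) S := by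
  intro μ hμ ν hν
  rw [integralFunctional_smul, integralFunctional_add (hg μ hμ) (hg ν hν)]
  push_cast
  ring

/-- A strongly continuous linear functional on `𝓔⁺(A)` is bounded. -/
lemma exists_sq_integralFunctional_le (hκ : IsKernel κ) (hE : EnergyPrinciple κ) {A : Set X}
    {g : X → ℝ≥0∞} (hc : IsStronglyContinuousOn κ (integralFunctional g) (energyConeOn κ A)) :
    ∃ R : ℝ, 0 ≤ R ∧ ∀ μ ∈ energyConeOn κ A,
      integralFunctional g μ ^ 2 ≤ R * energyForm κ μ μ := by
  by_contra! hcon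
  choose μ hμ hlt using fun n : ℕ => hcon ((n : ℝ) + 1) (by positivity)
  have hpos : ∀ n, 0 < integralFunctional g (μ n) := fun n => by
    refine lt_of_le_of_ne (integralFunctional_nonneg g _) fun h => ?_
    have h1 := hlt n
    rw [← h] at h1
    have h2 : 0 ≤ ((n : ℝ) + 1) * energyForm κ (μ n) (μ n) :=
      mul_nonneg (by positivity) (energyForm_nonneg _ _)
    linarith
  -- Rescaling to functional value 1 leaves energy at most 1/(n+1), so the measures tend strongly to
  -- 0 against continuity.
  set c : ℕ → ℝ≥0 := fun n => (integralFunctional g (μ n))⁻¹.toNNReal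
  have hcoe : ∀ n, (c n : ℝ) = (integralFunctional g (μ n))⁻¹ := fun n =>
    Real.coe_toNNReal _ (inv_nonneg.2 (hpos n).le)
  have hν : ∀ n, c n • μ n ∈ energyConeOn κ A := fun n => smul_mem_energyConeOn hκ (hμ n) _
  have hL : ∀ n, integralFunctional g (c n • μ n) = 1 := fun n => by
    rw [integralFunctional_smul, hcoe, inv_mul_cancel₀ (hpos n).ne']
  have hdist : ∀ n, strongDist κ (c n • μ n) 0 ≤ √(1 / ((n : ℝ) + 1)) := fun n => by
    refine Real.le_sqrt_of_sq_le ?_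
    rw [strongDist_sq hE (hν n).1 zero_mem_energyCone, energyForm_zero_right hκ (hν n).1,
      energyForm_zero_right hκ zero_mem_energyCone, energyForm_smul_self hκ (hμ n).1, hcoe,
      inv_pow, le_div_iff₀ (by positivity)]
    have h1 := hlt n
    have h2 : 0 < integralFunctional g (μ n) ^ 2 := pow_pos (hpos n) 2
    have h3 : (integralFunctional g (μ n) ^ 2)⁻¹ * (((n : ℝ) + 1) * energyForm κ (μ n) (μ n)) ≤ 1 := by
      rw [inv_mul_le_iff₀ h2]
      linarith
    linarith
  have hlim : StrongTendsto κ (fun n => c n • μ n) 0 := by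
    refine squeeze_zero (fun n => strongDist_nonneg _ _) hdist ?_
    simpa using (tendsto_one_div_add_atTop_nhds_zero_nat (𝕜 := ℝ)).sqrt
  have h := hc _ 0 hν zero_mem_energyConeOn hlim
  simp only [hL, integralFunctional_zero] at h
  exact one_ne_zero (tendsto_nhds_unique tendsto_const_nhds h)

lemma nonneg_of_forall_small {a b t₀ : ℝ} (ht₀ : 0 < t₀)
    (h : ∀ t, 0 < t → t ≤ t₀ → 0 ≤ 2 * t * a + t ^ 2 * b) : 0 ≤ a := by
  by_contra! ha
  have hb : 0 < |b| + 1 := by positivity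
  have hq : 0 < -a / (|b| + 1) := div_pos (by linarith) hb
  have ht : 0 < min t₀ (-a / (|b| + 1)) := lt_min ht₀ hq
  have h1 := h _ ht (min_le_left _ _)
  set t := min t₀ (-a / (|b| + 1)) with htdef
  have h2 : t * (|b| + 1) ≤ -a := (le_div_iff₀ hb).1 (min_le_right _ _)
  have h3 : 0 ≤ t * (2 * a + t * b) := by linarith
  have h4 := nonneg_of_mul_nonneg_right h3 ht
  have h5 : t * b ≤ t * |b| := by gcongr; exact le_abs_self b
  linarith

/-- First variation in the direction μ. Only small t are required, since under a mass constraint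
larger ones may be inadmissible. -/
lemma integralFunctional_le_of_variation (hκ : IsKernel κ) (hE : EnergyPrinciple κ)
    {g : X → ℝ≥0∞} {P μ : Measure X} (hP : P ∈ energyCone κ) (hμ : μ ∈ energyCone κ)
    (hgP : ∫⁻ x, g x ∂P ≠ ∞) (hgμ : ∫⁻ x, g x ∂μ ≠ ∞) {t₀ : ℝ} (ht₀ : 0 < t₀)
    (h : ∀ t : ℝ≥0, 0 < t → t ≤ t₀ → quadraticFunctional κ (integralFunctional g) P ≤
      quadraticFunctional κ (integralFunctional g) (P + t • μ)) :
    integralFunctional g μ ≤ energyForm κ P μ := by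
  refine sub_nonneg.1 (nonneg_of_forall_small ht₀ (b := energyForm κ μ μ) fun t ht htt => ?_)
  lift t to ℝ≥0 using ht.le
  have h1 := h t (by exact_mod_cast ht) htt
  unfold quadraticFunctional at h1
  have hfin : ∫⁻ x, g x ∂(t • μ) ≠ ∞ := by
    rw [lintegral_smul_measure, ENNReal.smul_def, smul_eq_mul]
    exact ENNReal.mul_ne_top ENNReal.coe_ne_top hgμ
  rw [energyForm_add_self hκ hE hP (smul_mem_energyCone hκ hμ t),
    energyForm_smul_right hκ hμ hP, energyForm_smul_self hκ hμ,
    integralFunctional_add hgP hfin, integralFunctional_smul] at h1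
  linarith

/-- First variation along (1 - t)P, which remains admissible when mass is bounded above. -/
lemma energyForm_self_le_of_variation (hκ : IsKernel κ) {g : X → ℝ≥0∞} {P : Measure X}
    (hP : P ∈ energyCone κ)
    (h : ∀ t : ℝ≥0, t ≤ 1 → quadraticFunctional κ (integralFunctional g) P ≤
      quadraticFunctional κ (integralFunctional g) (t • P)) :
    energyForm κ P P ≤ integralFunctional g P := by
  refine sub_nonneg.1 (nonneg_of_forall_small one_pos (b := energyForm κ P P) fun t ht htt => ?_)
  have h1 := h (1 - t).toNNReal (Real.toNNReal_le_one.2 (by linarith))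
  unfold quadraticFunctional at h1
  rw [energyForm_smul_self hκ hP, integralFunctional_smul,
    Real.coe_toNNReal _ (by linarith)] at h1
  linarith

/-- Apply the hypothesis to restrictions of μ to sets of finite measure. Requiring it only for
finite mass allows its use under a mass constraint. -/
lemma ae_le_potential_of_forall_lintegral_le (hκ : IsKernel κ) {A : Set X} {g : X → ℝ≥0∞}
    (hg : Measurable g) {P : Measure X} (hP : P ∈ energyCone κ)
    (h : ∀ μ ∈ energyConeOn κ A, μ univ ≠ ∞ → ∫⁻ x, g x ∂μ ≤ mutualEnergy κ P μ)
    {μ : Measure X} (hμ : μ ∈ energyConeOn κ A) : ∀ᵐ x ∂μ, g x ≤ potential κ P x := by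
  have := sigmaFinite_of_mem_radonCone hμ.1.1
  refine ae_le_of_forall_setLIntegral_le_of_sigmaFinite hg fun s _ hs => ?_
  have hr := restrict_mem_energyConeOn hκ hμ s
  refine (h _ hr (by simpa using hs.ne)).trans_eq ?_
  rw [mutualEnergy_comm hκ hP.1 hr.1.1, mutualEnergy_eq_lintegral hκ hP.1]

lemma potential_ae_eq_of_energyForm_le (hκ : IsKernel κ) {g : X → ℝ≥0∞}
    {P : Measure X} (hP : P ∈ energyCone κ) (hgP : ∫⁻ x, g x ∂P ≠ ∞)
    (h1 : ∀ᵐ x ∂P, g x ≤ potential κ P x) (h2 : energyForm κ P P ≤ integralFunctional g P) :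
    ∀ᵐ x ∂P, g x = potential κ P x := by
  refine ae_eq_of_ae_le_of_lintegral_le h1 hgP (hκ.measurable_potential hP.1).aemeasurable ?_
  rw [← mutualEnergy_eq_lintegral hκ hP.1]
  exact (ENNReal.toReal_le_toReal hP.2 hgP).1 h2

/-- Riesz-type representation: a strongly continuous functional `μ ↦ ∫ g dμ` on `𝓔⁺(A)` is
dominated by the potential of a measure of `𝓔⁺(A)` with equality almost everywhere with respect
to this measure. -/
theorem exists_projection (hκ : IsKernel κ) (hE : EnergyPrinciple κ) (hC : ConsistencyPrinciple κ)
    {A : Set X} (hA : IsStronglyClosed κ (energyConeOn κ A)) {g : X → ℝ≥0∞} (hg : Measurable g)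
    (hfin : ∀ μ ∈ energyConeOn κ A, ∫⁻ x, g x ∂μ ≠ ∞)
    (hc : IsStronglyContinuousOn κ (integralFunctional g) (energyConeOn κ A)) :
    ∃ P ∈ energyConeOn κ A, (∀ μ ∈ energyConeOn κ A, ∀ᵐ x ∂μ, g x ≤ potential κ P x) ∧
      ∀ᵐ x ∂P, g x = potential κ P x := by
  obtain ⟨R, hR0, hR⟩ := exists_sq_integralFunctional_le hκ hE hc
  -- From L² ≤ R·I one gets (2L)² ≤ 4RI ≤ (I + R)², so 2L ≤ I + R.
  have hb : ∀ μ ∈ energyConeOn κ A, -R ≤ quadraticFunctional κ (integralFunctional g) μ := by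
    intro μ hμ
    have h1 := hR μ hμ
    have h0 := energyForm_nonneg (κ := κ) μ μ
    have h2 : (2 * integralFunctional g μ) ^ 2 ≤ (energyForm κ μ μ + R) ^ 2 := by
      nlinarith [sq_nonneg (energyForm κ μ μ - R)]
    have h3 := abs_le_of_sq_le_sq h2 (by positivity)
    unfold quadraticFunctional
    linarith [le_abs_self (2 * integralFunctional g μ)]
  obtain ⟨P, hP, hmin⟩ := exists_minimizer hκ hE hC (fun _ hμ => hμ.1)
    (isMidpointConvex_energyConeOn hκ hE A) hA ⟨0, zero_mem_energyConeOn⟩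
    (isMidpointAffineOn_integralFunctional hfin) hc hb
  have h1 : ∀ μ ∈ energyConeOn κ A, ∀ᵐ x ∂μ, g x ≤ potential κ P x := fun μ hμ => by
    refine ae_le_potential_of_forall_lintegral_le hκ hg hP.1 (A := A) (fun ν hν _ => ?_) hμ
    refine (ENNReal.toReal_le_toReal (hfin ν hν) (mutualEnergy_ne_top hE hP.1 hν.1)).1 ?_
    exact integralFunctional_le_of_variation hκ hE hP.1 hν.1 (hfin P hP) (hfin ν hν) one_pos
      fun t _ _ => hmin _ (add_mem_energyConeOn hκ hE hP (smul_mem_energyConeOn hκ hν t))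
  exact ⟨P, hP, h1, potential_ae_eq_of_energyForm_le hκ hP.1 (hfin P hP) (h1 P hP)
    (energyForm_self_le_of_variation hκ hP.1 fun t _ => hmin _ (smul_mem_energyConeOn hκ hP t))⟩

lemma exists_compactlySupported_eqOn {K : Set X} (hK : IsCompact K) {f : X → ℝ}
    (hf : ContinuousOn f K) : ∃ φ : C_c(X, ℝ), ∀ x ∈ K, φ x = f x := by
  obtain ⟨G, hG⟩ := ContinuousMap.exists_restrict_eq hK.isClosed
    (⟨K.domRestrict f, continuousOn_iff_continuous_domRestrict.1 hf⟩ : C(K, ℝ))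
  obtain ⟨u, -, -, hu, -⟩ := exists_urysohn hK isOpen_univ (subset_univ K)
  refine ⟨⟨G * u.toContinuousMap, u.hasCompactSupport.mul_left⟩, fun x hx => ?_⟩
  have h1 : G x = f x := congrArg (fun F : C(K, ℝ) => F ⟨x, hx⟩) hG
  change G x * u x = f x
  rw [h1, hu x hx, mul_one]

/-! ### Functionals and equilibrium measures on compact sets. -/

section Compact

variable {K : Set X} {g : X → ℝ≥0∞}

lemma lintegral_ne_top_of_isCompact (hK : IsCompact K) (hgK : ContinuousOn g K)
    (hfin : ∀ x ∈ K, g x ≠ ∞) {μ : Measure X} (hμ : μ ∈ energyConeOn κ K) :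
    ∫⁻ x, g x ∂μ ≠ ∞ := by
  have : IsFiniteMeasureOnCompacts μ := hμ.1.1
  have hae : ∀ᵐ x ∂μ, x ∈ K := hμ.2
  rcases K.eq_empty_or_nonempty with rfl | hne
  · have : μ = 0 := by
      rw [← Measure.measure_univ_eq_zero, ← compl_empty]
      exact hμ.2
    simp [this]
  obtain ⟨x₀, hx₀, hmax⟩ := hK.exists_isMaxOn hne hgK
  have huniv : μ univ ≤ μ K := by
    rw [← union_compl_self K]
    exact (measure_union_le _ _).trans (by rw [hμ.2, add_zero])
  refine ((lintegral_mono_ae (g := fun _ => g x₀) ?_).trans_lt ?_).ne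
  · filter_upwards [hae] with x hx using hmax hx
  · rw [lintegral_const]
    exact ENNReal.mul_lt_top (hfin x₀ hx₀).lt_top (huniv.trans_lt hK.measure_lt_top)

/-- For measures on K, g may be replaced by a compactly supported continuous extension, so vague
convergence suffices. -/
lemma isStronglyContinuousOn_of_isCompact (hC : ConsistencyPrinciple κ) (hK : IsCompact K)
    (hg : Measurable g) (hgK : ContinuousOn g K) (hfin : ∀ x ∈ K, g x ≠ ∞) :
    IsStronglyContinuousOn κ (integralFunctional g) (energyConeOn κ K) := by
  obtain ⟨φ, hφ⟩ := exists_compactlySupported_eqOn hK (f := fun x => (g x).toReal)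
    (ENNReal.continuousOn_toReal.comp hgK hfin)
  have key : ∀ μ ∈ energyConeOn κ K, integralFunctional g μ = ∫ x, φ x ∂μ := fun μ hμ => by
    have hae : ∀ᵐ x ∂μ, x ∈ K := hμ.2
    unfold integralFunctional
    rw [← integral_toReal hg.aemeasurable (by
      filter_upwards [hae] with x hx using (hfin x hx).lt_top)]
    refine integral_congr_ae ?_
    filter_upwards [hae] with x hx using (hφ x hx).symm
  intro μ ν hμ hν h
  rw [key ν hν]
  exact (h.vagueTendsto hC (fun n => (hμ n).1) hν.1 φ).congr fun n => (key _ (hμ n)).symm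

lemma exists_projection_of_isCompact (hκ : IsKernel κ) (hE : EnergyPrinciple κ)
    (hC : ConsistencyPrinciple κ) (hK : IsCompact K) (hg : Measurable g) (hgK : ContinuousOn g K)
    (hfin : ∀ x ∈ K, g x ≠ ∞) :
    ∃ P ∈ energyConeOn κ K, (∀ μ ∈ energyConeOn κ K, ∀ᵐ x ∂μ, g x ≤ potential κ P x) ∧
      ∀ᵐ x ∂P, g x = potential κ P x :=
  exists_projection hκ hE hC (isStronglyClosed_energyConeOn_of_isClosed hC hK.isClosed) hg
    (fun _ hμ => lintegral_ne_top_of_isCompact hK hgK hfin hμ)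
    (isStronglyContinuousOn_of_isCompact hC hK hg hgK hfin)

/-- Equilibrium measures of compact sets. -/
lemma exists_equilibrium (hκ : IsKernel κ) (hE : EnergyPrinciple κ)
    (hC : ConsistencyPrinciple κ) {M : ℝ≥0} (hM : UgaheriPrincipleWith κ M) (hK : IsCompact K) :
    ∃ γ ∈ energyConeOn κ K, (∀ μ ∈ energyConeOn κ K, ∀ᵐ x ∂μ, 1 ≤ potential κ γ x) ∧
      ∀ x, potential κ γ x ≤ M := by
  obtain ⟨γ, hγ, h1, h2⟩ := exists_projection_of_isCompact hκ hE hC hK (g := fun _ => 1)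
    measurable_const continuousOn_const (fun _ _ => ENNReal.one_ne_top)
  refine ⟨γ, hγ, h1, fun x => ?_⟩
  -- The potential equals 1 γ-a.e., so the maximum principle applies with c = 1.
  have := hM γ hγ.1 1 one_pos (by filter_upwards [h2] with x hx using by simp [← hx]) x
  simpa using this

/-- A measure `ν ∈ 𝓔⁺` with `U^ν ≤ U^ω` n.e. on `K` satisfies `ν(K) ≤ M ω(X)`. -/
lemma measure_univ_le_of_potential_le (hκ : IsKernel κ) (hE : EnergyPrinciple κ)
    (hC : ConsistencyPrinciple κ) {M : ℝ≥0} (hM : UgaheriPrincipleWith κ M) (hK : IsCompact K)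
    {ν ω : Measure X} (hν : ν ∈ energyCone κ) (hω : ω ∈ radonCone X)
    (h : ∀ μ ∈ energyConeOn κ K, ∫⁻ x, potential κ ν x ∂μ ≤ ∫⁻ x, potential κ ω x ∂μ) :
    ν K ≤ M * ω univ := by
  obtain ⟨γ, hγ, h1, h2⟩ := exists_equilibrium hκ hE hC hM hK
  -- The equilibrium potential is at least 1 ν-a.e. on K and at most M everywhere; symmetry moves
  -- the inequality between U^ν and U^ω onto γ.
  calc ν K = ∫⁻ _, 1 ∂(ν.restrict K) := by simp
    _ ≤ ∫⁻ x, potential κ γ x ∂(ν.restrict K) := lintegral_mono_ae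
        (h1 _ (restrict_mem_energyConeOn_of_measurableSet hκ hν hK.measurableSet))
    _ ≤ ∫⁻ x, potential κ γ x ∂ν := lintegral_mono' Measure.restrict_le_self le_rfl
    _ = ∫⁻ x, potential κ ν x ∂γ := by
        rw [← mutualEnergy_eq_lintegral hκ hγ.1.1, ← mutualEnergy_eq_lintegral hκ hν.1,
          mutualEnergy_comm hκ hν.1 hγ.1.1]
    _ ≤ ∫⁻ x, potential κ ω x ∂γ := h γ hγ
    _ = ∫⁻ x, potential κ γ x ∂ω := by
        rw [← mutualEnergy_eq_lintegral hκ hγ.1.1, ← mutualEnergy_eq_lintegral hκ hω,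
          mutualEnergy_comm hκ hω hγ.1.1]
    _ ≤ ∫⁻ _, M ∂ω := lintegral_mono h2
    _ = M * ω univ := by simp

end Compact

end Projection

/-! ### Existence, uniqueness and energy of the inner balayage. -/

section Balayage

variable {X : Type*} [TopologicalSpace X] [T2Space X] [LocallyCompactSpace X]
  [SecondCountableTopology X] [MeasurableSpace X] [BorelSpace X] {κ : X → X → ℝ≥0∞}

/-- Fatou's lemma applied to the kernel. -/
lemma IsKernel.lowerSemicontinuous_potential (hκ : IsKernel κ) {μ : Measure X} :
    LowerSemicontinuous (potential κ μ) := by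
  rw [lowerSemicontinuous_iff_le_liminf]
  intro x
  have hmeas : ∀ x' : X, Measurable (κ x') := fun x' =>
    hκ.measurable.comp (measurable_const.prodMk measurable_id)
  refine le_trans (lintegral_mono fun y => ?_) (lintegral_liminf_le hmeas)
  have h : LowerSemicontinuous (fun x' => κ x' y) :=
    fun x' c hc => (Continuous.prodMk_left (X := X) y).continuousAt.eventually
      (hκ.lsc (x', y) c hc)
  exact lowerSemicontinuous_iff_le_liminf.1 h x

lemma continuousOn_potential (hκ : IsKernel κ) {μ : Measure X} {K : Set X}
    (h : UpperSemicontinuousOn (potential κ μ) K) : ContinuousOn (potential κ μ) K := by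
  intro x hx
  refine tendsto_order.2 ⟨fun a ha => ?_, fun a ha => ?_⟩
  · exact nhdsWithin_le_nhds (lowerSemicontinuousAt_iff.1 (hκ.lowerSemicontinuous_potential x) a ha)
  · exact upperSemicontinuousWithinAt_iff.1 (upperSemicontinuousOn_iff.1 h x hx) a ha

lemma potential_ae_eq_of_forall_lintegral_eq (hκ : IsKernel κ) {A : Set X} {ω ν : Measure X}
    (hω : ω ∈ radonCone X) (hν : ν ∈ radonCone X)
    (h : ∀ μ ∈ energyConeOn κ A, ∫⁻ x, potential κ ν x ∂μ = ∫⁻ x, potential κ ω x ∂μ)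
    {μ : Measure X} (hμ : μ ∈ energyConeOn κ A) : ∀ᵐ x ∂μ, potential κ ν x = potential κ ω x := by
  have := sigmaFinite_of_mem_radonCone hμ.1.1
  exact ae_eq_of_forall_setLIntegral_eq_of_sigmaFinite (hκ.measurable_potential hν)
    (hκ.measurable_potential hω) fun s _ _ => h _ (restrict_mem_energyConeOn hκ hμ s)

/-- Lets ω, possibly of infinite energy, be replaced by its balayage in every pairing with 𝓔⁺(A). -/
lemma IsInnerBalayage.lintegral_eq (hκ : IsKernel κ) (hE : EnergyPrinciple κ) {A : Set X}
    {ω ν : Measure X} (hω : ω ∈ radonCone X) (h : IsInnerBalayage κ ω A ν) {μ : Measure X}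
    (hμ : μ ∈ energyConeOn κ A) :
    ∫⁻ x, potential κ ω x ∂μ = mutualEnergy κ ν μ := by
  rw [mutualEnergy_comm hκ h.1.1.1 hμ.1.1, mutualEnergy_eq_lintegral hκ h.1.1.1]
  refine lintegral_congr_ae ?_
  filter_upwards [(nearlyEverywhereOn_iff hκ hE (measurableSet_eq_fun
    (hκ.measurable_potential h.1.1.1) (hκ.measurable_potential hω))).1 h.2 μ hμ] with x hx
    using hx.symm

lemma IsInnerBalayage.unique (hκ : IsKernel κ) (hE : EnergyPrinciple κ) {A : Set X}
    {ω ν ν' : Measure X} (hω : ω ∈ radonCone X) (h : IsInnerBalayage κ ω A ν)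
    (h' : IsInnerBalayage κ ω A ν') : ν = ν' := by
  refine eq_of_energyForm_le hE h.1.1 h'.1.1 ?_
  have h1 : energyForm κ ν' ν' = energyForm κ ν ν' := by
    unfold energyForm
    rw [← h.lintegral_eq hκ hE hω h'.1, ← h'.lintegral_eq hκ hE hω h'.1]
  have h2 : energyForm κ ν ν = energyForm κ ν' ν := by
    unfold energyForm
    rw [← h.lintegral_eq hκ hE hω h.1, ← h'.lintegral_eq hκ hE hω h.1]
  rw [h1, h2, energyForm_comm hκ h'.1.1 h.1.1]
  linarith

/-- By the domination principle, the projection of `U^ω` is its balayage. -/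
lemma potential_ae_eq_of_projection (hD : DominationPrinciple κ) {A : Set X}
    {ω P : Measure X} (hω : ω ∈ radonCone X) (hP : P ∈ energyConeOn κ A)
    (h1 : ∀ μ ∈ energyConeOn κ A, ∀ᵐ x ∂μ, potential κ ω x ≤ potential κ P x)
    (h2 : ∀ᵐ x ∂P, potential κ ω x = potential κ P x) :
    ∀ μ ∈ energyConeOn κ A, ∀ᵐ x ∂μ, potential κ P x = potential κ ω x := by
  have h3 := hD P hP.1 ω hω (by filter_upwards [h2] with x hx using hx.ge)
  intro μ hμ
  filter_upwards [h1 μ hμ] with x hx using le_antisymm (h3 x) hx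

lemma integralFunctional_potential (hκ : IsKernel κ) {ω : Measure X} (hω : ω ∈ radonCone X)
    (μ : Measure X) : integralFunctional (potential κ ω) μ = energyForm κ μ ω := by
  unfold integralFunctional energyForm
  rw [mutualEnergy_eq_lintegral hκ hω]

lemma isStronglyContinuousOn_potential (hκ : IsKernel κ) (hE : EnergyPrinciple κ)
    {ω : Measure X} (hω : ω ∈ energyCone κ) :
    IsStronglyContinuousOn κ (integralFunctional (potential κ ω)) (energyCone κ) := by
  intro μ ν hμ hν h
  simp_rw [integralFunctional_potential hκ hω.1]
  rw [energyForm_comm hκ hν hω]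
  refine (tendsto_energyForm_left hκ hE hμ hν hω h).congr fun n => ?_
  rw [energyForm_comm hκ hω (hμ n)]

lemma exists_isInnerBalayage_of_mem_energyCone (hκ : IsKernel κ) (hE : EnergyPrinciple κ)
    (hC : ConsistencyPrinciple κ) (hD : DominationPrinciple κ) {A : Set X}
    (hA : IsStronglyClosed κ (energyConeOn κ A)) {ω : Measure X} (hω : ω ∈ energyCone κ) :
    ∃ ν, IsInnerBalayage κ ω A ν := by
  obtain ⟨P, hP, h1, h2⟩ := exists_projection hκ hE hC hA (hκ.measurable_potential hω.1)
    (fun μ hμ => by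
      rw [← mutualEnergy_eq_lintegral hκ hω.1]
      exact mutualEnergy_ne_top hE hμ.1 hω)
    ((isStronglyContinuousOn_potential hκ hE hω).mono fun _ hμ => hμ.1)
  exact ⟨P, hP, nearlyEverywhereOn_of_isCompact fun K hK _ μ hμ =>
    potential_ae_eq_of_projection hD hω.1 hP h1 h2 μ (energyConeOn_mono hK hμ)⟩

lemma exists_isInnerBalayage_of_isCompact (hκ : IsKernel κ) (hE : EnergyPrinciple κ)
    (hC : ConsistencyPrinciple κ) (hD : DominationPrinciple κ) {K : Set X} (hK : IsCompact K)
    {ω : Measure X} (hω : ω ∈ radonCone X) (hcont : ContinuousOn (potential κ ω) K)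
    (hfin : ∀ x ∈ K, potential κ ω x ≠ ∞) : ∃ ν, IsInnerBalayage κ ω K ν := by
  obtain ⟨P, hP, h1, h2⟩ := exists_projection_of_isCompact hκ hE hC hK
    (hκ.measurable_potential hω) hcont hfin
  exact ⟨P, hP, nearlyEverywhereOn_of_isCompact fun K hK _ μ hμ =>
    potential_ae_eq_of_projection hD hω hP h1 h2 μ (energyConeOn_mono hK hμ)⟩

/-- I(ν) = ∫U^ω dν ≤ C ν(K), and equilibrium measures bound ν(K). The gain is a bound independent of
K. -/
lemma IsInnerBalayage.energy_le (hκ : IsKernel κ) (hE : EnergyPrinciple κ)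
    (hC : ConsistencyPrinciple κ) {M : ℝ≥0} (hM : UgaheriPrincipleWith κ M) {K : Set X}
    (hK : IsCompact K) {ω ν : Measure X} (hω : ω ∈ radonCone X) (h : IsInnerBalayage κ ω K ν)
    {C : ℝ≥0} (hle : ∀ x ∈ K, potential κ ω x ≤ C) :
    energy κ ν ≤ C * (M * ω univ) := by
  have hmass : ν K ≤ M * ω univ := by
    refine measure_univ_le_of_potential_le hκ hE hC hM hK h.1.1 hω fun μ hμ => ?_
    rw [h.lintegral_eq hκ hE hω hμ, mutualEnergy_comm hκ h.1.1.1 hμ.1.1,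
      mutualEnergy_eq_lintegral hκ h.1.1.1]
  have hae : ∀ᵐ x ∂ν, x ∈ K := h.1.2
  have huniv : ν univ ≤ ν K := by
    rw [← union_compl_self K]
    exact (measure_union_le _ _).trans (by rw [h.1.2, add_zero])
  calc energy κ ν = ∫⁻ x, potential κ ω x ∂ν := (h.lintegral_eq hκ hE hω h.1).symm
    _ ≤ ∫⁻ _, C ∂ν := lintegral_mono_ae (by filter_upwards [hae] with x hx using hle x hx)
    _ = C * ν univ := by simp
    _ ≤ C * (M * ω univ) := by gcongr; exact huniv.trans hmass

/-- Pythagoras: both balayages have the same pairing with ν, so I(ν', ν) = I(ν). -/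
lemma IsInnerBalayage.strongDist_sq_of_subset (hκ : IsKernel κ) (hE : EnergyPrinciple κ)
    {K K' : Set X} (hKK' : K ⊆ K') {ω ν ν' : Measure X} (hω : ω ∈ radonCone X)
    (h : IsInnerBalayage κ ω K ν) (h' : IsInnerBalayage κ ω K' ν') :
    strongDist κ ν' ν ^ 2 = energyForm κ ν' ν' - energyForm κ ν ν := by
  have h1 : energyForm κ ν ν = energyForm κ ν' ν := by
    unfold energyForm
    rw [← h.lintegral_eq hκ hE hω h.1, ← h'.lintegral_eq hκ hE hω (energyConeOn_mono hKK' h.1)]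
  rw [strongDist_sq hE h'.1.1 h.1.1, ← h1]
  ring

/-- If the balayages onto the compact subsets of `A` exist and have bounded energy, then the
balayage onto `A` exists. -/
lemma exists_isInnerBalayage_of_forall_isCompact (hκ : IsKernel κ) (hE : EnergyPrinciple κ)
    (hC : ConsistencyPrinciple κ) {A : Set X} (hA : IsStronglyClosed κ (energyConeOn κ A))
    {ω : Measure X} (hω : ω ∈ radonCone X) {R : ℝ}
    (hex : ∀ K ⊆ A, IsCompact K → ∃ ν, IsInnerBalayage κ ω K ν ∧ energyForm κ ν ν ≤ R) :
    ∃ ν, IsInnerBalayage κ ω A ν := by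
  choose! P hP hPR using hex
  set e : Set X → ℝ := fun K => energyForm κ (P K) (P K)
  have hmono : ∀ {K K' : Set X}, K ⊆ K' → K' ⊆ A → IsCompact K → IsCompact K' →
      strongDist κ (P K') (P K) ^ 2 = e K' - e K := fun {K K'} h hA hK hK' =>
    (hP K (h.trans hA) hK).strongDist_sq_of_subset hκ hE h hω (hP K' hA hK')
  set T : Set ℝ := e '' {K | K ⊆ A ∧ IsCompact K}
  have hTb : BddAbove T := ⟨R, by rintro _ ⟨K, hK, rfl⟩; exact hPR K hK.1 hK.2⟩
  have hTne : T.Nonempty := ⟨_, ∅, ⟨empty_subset _, isCompact_empty⟩, rfl⟩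
  have hex : ∀ n : ℕ, ∃ K, (K ⊆ A ∧ IsCompact K) ∧ sSup T - 1 / ((n : ℝ) + 1) < e K := fun n => by
    obtain ⟨_, ⟨K, hK, rfl⟩, h⟩ := exists_lt_of_lt_csSup hTne
      (sub_lt_self (sSup T) (Nat.one_div_pos_of_nat (n := n)))
    exact ⟨K, hK, h⟩
  choose K₀ hK₀ hK₀e using hex
  -- Finite unions make the sequence increasing; by Pythagoras energies grow with the set, so they
  -- still approach the supremum.
  set K : ℕ → Set X := fun n => ⋃ i ∈ Finset.range (n + 1), K₀ i
  have hKA : ∀ n, K n ⊆ A := fun n => iUnion₂_subset fun i _ => (hK₀ i).1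
  have hKc : ∀ n, IsCompact (K n) := fun n =>
    (Finset.range (n + 1)).isCompact_biUnion fun i _ => (hK₀ i).2
  have hKm : Monotone K := fun n m h => biUnion_subset_biUnion_left fun i hi => by
    simp only [Finset.coe_range, mem_Iio] at hi ⊢
    omega
  have hKe : ∀ n : ℕ, sSup T - 1 / ((n : ℝ) + 1) < e (K n) := fun n => by
    have hsub : K₀ n ⊆ K n := subset_biUnion_of_mem (u := K₀) (by simp)
    have := hmono hsub (hKA n) (hK₀ n).2 (hKc n)
    linarith [hK₀e n, sq_nonneg (strongDist κ (P (K n)) (P (K₀ n)))]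
  have hsup : ∀ K, K ⊆ A → IsCompact K → e K ≤ sSup T := fun K h1 h2 =>
    le_csSup hTb ⟨K, ⟨h1, h2⟩, rfl⟩
  have hdist : ∀ (n : ℕ) (K' : Set X), K n ⊆ K' → K' ⊆ A → IsCompact K' →
      strongDist κ (P K') (P (K n)) ^ 2 ≤ 1 / ((n : ℝ) + 1) := fun n K' h1 h2 h3 => by
    rw [hmono h1 h2 (hKc n) h3]
    linarith [hKe n, hsup K' h2 h3]
  have hPn : ∀ n, IsInnerBalayage κ ω (K n) (P (K n)) := fun n => hP _ (hKA n) (hKc n)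
  have hlim0 := tendsto_one_div_add_atTop_nhds_zero_nat (𝕜 := ℝ)
  obtain ⟨ν, hν, hlim⟩ := hC.complete (fun n => P (K n)) (fun n => (hPn n).1.1) (by
    intro ε hε
    obtain ⟨N, hN⟩ := eventually_atTop.1
      (hlim0.eventually_lt_const (show 0 < ε ^ 2 by positivity))
    have key : ∀ i ≥ N, ∀ j ≥ i, strongDist κ (P (K j)) (P (K i)) < ε := fun i hi j hj =>
      lt_of_pow_lt_pow_left₀ 2 hε.le
        ((hdist i _ (hKm hj) (hKA j) (hKc j)).trans_lt (hN i hi))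
    refine ⟨N, fun i hi j hj => ?_⟩
    rcases le_total i j with h | h
    · rw [strongDist_comm hκ (hPn i).1.1 (hPn j).1.1]
      exact key i hi j h
    · exact key j hj i h)
  have hνA : ν ∈ energyConeOn κ A :=
    hA _ ν (fun n => energyConeOn_mono (hKA n) (hPn n).1) hν hlim
  refine ⟨ν, hνA, nearlyEverywhereOn_of_isCompact fun K' hK'A hK' => ?_⟩
  refine fun σ hσ => potential_ae_eq_of_forall_lintegral_eq hκ hω hν.1 (fun μ hμ => ?_) hσ
  -- The balayage onto `K' ∪ K n` links both sides: containing `K'`, it pairs correctly with μ;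
  -- containing `K n`, it is strongly close to the balayage onto `K n`.
  have hU : ∀ n, K' ∪ K n ⊆ A := fun n => union_subset hK'A (hKA n)
  have hUc : ∀ n, IsCompact (K' ∪ K n) := fun n => hK'.union (hKc n)
  have hQ : ∀ n, IsInnerBalayage κ ω (K' ∪ K n) (P (K' ∪ K n)) := fun n => hP _ (hU n) (hUc n)
  have hQL : ∀ n, ∫⁻ x, potential κ ω x ∂μ = mutualEnergy κ (P (K' ∪ K n)) μ := fun n =>
    (hQ n).lintegral_eq hκ hE hω (energyConeOn_mono subset_union_left hμ)
  have hfin : ∫⁻ x, potential κ ω x ∂μ ≠ ∞ := hQL 0 ▸ mutualEnergy_ne_top hE (hQ 0).1.1 hμ.1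
  have hQL' : ∀ n, energyForm κ μ (P (K' ∪ K n)) = integralFunctional (potential κ ω) μ :=
    fun n => by
      rw [energyForm_comm hκ hμ.1 (hQ n).1.1]
      exact congrArg ENNReal.toReal (hQL n).symm
  have hd0 : Tendsto (fun n => strongDist κ (P (K' ∪ K n)) (P (K n))) atTop (𝓝 0) := by
    refine squeeze_zero (fun _ => strongDist_nonneg _ _) (fun n => Real.le_sqrt_of_sq_le
      (hdist n _ subset_union_right (hU n) (hUc n))) ?_
    simpa using hlim0.sqrt
  have hlim1 : Tendsto (fun n => energyForm κ μ (P (K n))) atTop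
      (𝓝 (integralFunctional (potential κ ω) μ)) := by
    rw [tendsto_iff_dist_tendsto_zero]
    refine squeeze_zero (fun _ => dist_nonneg) (fun n => ?_)
      (by simpa using hd0.const_mul (√(energyForm κ μ μ)))
    rw [dist_comm, Real.dist_eq, ← hQL' n]
    exact abs_energyForm_sub_le hκ hE (hQ n).1.1 (hPn n).1.1 hμ.1
  have hlim2 := tendsto_energyForm_left hκ hE (fun n => (hPn n).1.1) hν hμ.1 hlim
  have heq := tendsto_nhds_unique hlim1 hlim2
  rw [← mutualEnergy_eq_lintegral hκ hν.1]
  exact ((ENNReal.toReal_eq_toReal_iff' hfin (mutualEnergy_ne_top hE hμ.1 hν)).1 heq).symm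

lemma IsAdmissibleSource.mono {ω : Measure X} {A B : Set X} (h : IsAdmissibleSource κ ω B)
    (hAB : A ⊆ B) : IsAdmissibleSource κ ω A :=
  h.imp_right fun ⟨h1, h2, C, h3⟩ => ⟨h1, fun K hK hKA => h2 K hK (hKA.trans hAB), C,
    fun x hx => h3 x (hAB hx)⟩

/-- Existence of the inner balayage. -/
theorem exists_isInnerBalayage (hκ : IsKernel κ) (hE : EnergyPrinciple κ)
    (hC : ConsistencyPrinciple κ) (hD : DominationPrinciple κ) (hU : UgaheriPrinciple κ)
    {A : Set X} (hA : IsStronglyClosed κ (energyConeOn κ A)) {ω : Measure X}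
    (hω : ω ∈ radonCone X) (hadm : IsAdmissibleSource κ ω A) : ∃ ν, IsInnerBalayage κ ω A ν := by
  rcases hadm with hfin | ⟨hmass, husc, C, hle⟩
  · exact exists_isInnerBalayage_of_mem_energyCone hκ hE hC hD hA ⟨hω, hfin⟩
  obtain ⟨M, -, hM⟩ := hU
  have htop : (C : ℝ≥0∞) * (M * ω univ) ≠ ∞ :=
    ENNReal.mul_ne_top ENNReal.coe_ne_top (ENNReal.mul_ne_top ENNReal.coe_ne_top hmass.ne)
  refine exists_isInnerBalayage_of_forall_isCompact hκ hE hC hA hω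
    (R := ((C : ℝ≥0∞) * (M * ω univ)).toReal) fun K hKA hK => ?_
  obtain ⟨ν, hν⟩ := exists_isInnerBalayage_of_isCompact hκ hE hC hD hK hω
    (continuousOn_potential hκ (husc K hK hKA))
    (fun x hx => ((hle x (hKA hx)).trans_lt ENNReal.coe_lt_top).ne)
  exact ⟨ν, hν, ENNReal.toReal_mono htop
    (hν.energy_le hκ hE hC hM hK hω fun x hx => hle x (hKA hx))⟩

end Balayage

/-! ### Control of the total mass, and the Gauss problem. -/

section GaussProblem

variable {X : Type*} [TopologicalSpace X] [T2Space X] [LocallyCompactSpace X]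
  [SecondCountableTopology X] [MeasurableSpace X] [BorelSpace X] {κ : X → X → ℝ≥0∞}

/-- The measures in `𝓔⁺(A)` whose total mass satisfies `p`. -/
def massClass (κ : X → X → ℝ≥0∞) (p : ℝ≥0∞ → Prop) (A : Set X) : Set (Measure X) :=
  {μ | μ ∈ energyConeOn κ A ∧ p (μ univ)}

lemma massClass_mono {p : ℝ≥0∞ → Prop} {A B : Set X} (h : A ⊆ B) :
    massClass κ p A ⊆ massClass κ p B := fun _ hμ => ⟨energyConeOn_mono h hμ.1, hμ.2⟩

lemma massClass_iInter {p : ℝ≥0∞ → Prop} (A : ℕ → Set X) :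
    massClass κ p (⋂ j, A j) = ⋂ j, massClass κ p (A j) := by
  ext μ
  simp only [mem_iInter]
  refine ⟨fun h j => massClass_mono (iInter_subset A j) h, fun h => ⟨⟨(h 0).1.1, ?_⟩, (h 0).2⟩⟩
  rw [compl_iInter]
  exact measure_iUnion_null fun j => (h j).1.2

lemma isStronglyClosed_energyConeOn_iInter {A : ℕ → Set X}
    (h : ∀ j, IsStronglyClosed κ (energyConeOn κ (A j))) :
    IsStronglyClosed κ (energyConeOn κ (⋂ j, A j)) := by
  intro μ ν hμ hν hlim
  refine ⟨hν, ?_⟩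
  rw [compl_iInter]
  exact measure_iUnion_null fun j =>
    (h j μ ν (fun n => energyConeOn_mono (iInter_subset A j) (hμ n)) hν hlim).2

lemma isMidpointConvex_massClass (hκ : IsKernel κ) (hE : EnergyPrinciple κ) {p : ℝ≥0∞ → Prop}
    (hp : ∀ a b, p a → p b → p (2⁻¹ * (a + b))) (A : Set X) :
    IsMidpointConvex (massClass κ p A) := fun μ hμ ν hν => by
  refine ⟨isMidpointConvex_energyConeOn hκ hE A μ hμ.1 ν hν.1, ?_⟩
  have h : ((2⁻¹ : ℝ≥0) • (μ + ν)) univ = 2⁻¹ * (μ univ + ν univ) := by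
    rw [Measure.smul_apply, Measure.add_apply, ENNReal.smul_def, smul_eq_mul,
      ENNReal.coe_inv two_ne_zero, ENNReal.coe_ofNat]
  rw [h]
  exact hp _ _ hμ.2 hν.2

lemma inv_two_mul_add_self_of_eq_one (a b : ℝ≥0∞) (ha : a = 1) (hb : b = 1) :
    2⁻¹ * (a + b) = 1 := by
  rw [ha, hb, one_add_one_eq_two]
  exact ENNReal.inv_mul_cancel two_ne_zero ENNReal.ofNat_ne_top

lemma inv_two_mul_add_self_of_le_one (a b : ℝ≥0∞) (ha : a ≤ 1) (hb : b ≤ 1) :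
    2⁻¹ * (a + b) ≤ 1 :=
  (mul_le_mul_right (add_le_add ha hb) _).trans_eq (inv_two_mul_add_self_of_eq_one 1 1 rfl rfl)

lemma VagueTendsto.eq_zero {μ : ℕ → Measure X} {ν : Measure X} (h : VagueTendsto μ ν)
    (hν : ν ∈ radonCone X) (h0 : ∀ K, IsCompact K → ∀ᶠ n in atTop, μ n K = 0) : ν = 0 := by
  rw [← Measure.measure_univ_eq_zero]
  by_contra hne
  obtain ⟨K, -, hK, hlt⟩ := exists_isCompact_lt hν (B := univ) (by simp) (pos_iff_ne_zero.2 hne)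
  obtain ⟨φ, hφ0, -, hφ1, -⟩ := exists_urysohn hK isOpen_univ (subset_univ K)
  have hlim : Tendsto (fun n => ∫ x, φ x ∂(μ n)) atTop (𝓝 0) := by
    refine tendsto_const_nhds.congr' ?_
    filter_upwards [h0 _ φ.hasCompactSupport] with n hn
    symm
    refine integral_eq_zero_of_ae ?_
    have : ∀ᵐ x ∂(μ n), x ∉ tsupport φ := measure_eq_zero_iff_ae_notMem.1 hn
    filter_upwards [this] with x hx using image_eq_zero_of_notMem_tsupport hx
  have h1 := measure_le_ofReal_integral hν φ hφ0 hK.measurableSet fun x hx => (hφ1 x hx).ge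
  rw [tendsto_nhds_unique (h φ) hlim, ENNReal.ofReal_zero] at h1
  exact absurd hlt (not_lt.2 h1)

/-- If `c_*(A) < ∞`, then unit measures carried by the part of `A` far away have large energy. -/
lemma exists_isCompact_lt_energyForm (hκ : IsKernel κ) (hE : EnergyPrinciple κ)
    (hC : ConsistencyPrinciple κ) {A : Set X} (hA : innerCapacity κ A < ∞) (R : ℝ) :
    ∃ K, IsCompact K ∧ ∀ μ ∈ massClass κ (· = 1) (A \ K), R < energyForm κ μ μ := by
  -- Otherwise almost minimizers of the energy over unit measures off an exhaustion converge
  -- strongly. The limit has no mass on compact sets, so energies tend to 0, contradicting 1 ≤ I(μ)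
  -- c_*(A).
  by_contra! hcon
  set E := CompactExhaustion.choice X
  set S : ℕ → Set (Measure X) := fun j => massClass κ (· = 1) (A \ E j)
  have hanti : Antitone S := fun i j h => massClass_mono (sdiff_subset_sdiff_right (E.subset h))
  have hquad : ∀ μ : Measure X, quadraticFunctional κ (fun _ => 0) μ = energyForm κ μ μ :=
    fun μ => by simp [quadraticFunctional]
  have hb : ∀ j, ∀ μ ∈ S j, 0 ≤ quadraticFunctional κ (fun _ => 0) μ := fun _ μ _ => by
    rw [hquad]
    exact energyForm_nonneg μ μ
  choose ρ hρ hρR using fun j => hcon (E j) (E.isCompact j)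
  choose μ hμ hmin using fun j : ℕ =>
    exists_almost_minimizer (hb j) ⟨ρ j, hρ j⟩ (Nat.one_div_pos_of_nat (α := ℝ) (n := j))
  obtain ⟨ν, hν, hlim⟩ := exists_strongTendsto_of_almost_minimizers hκ hE hC
    (fun _ h => h.1.1) hanti
    (fun j => isMidpointConvex_massClass hκ hE inv_two_mul_add_self_of_eq_one _)
    (fun _ _ _ _ => by simp) (hb 0) hμ
    (tendsto_one_div_add_atTop_nhds_zero_nat (𝕜 := ℝ)) hmin (B := R + 1) (fun j => by
      have h1 := hmin j _ (hρ j)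
      rw [hquad (ρ j)] at h1
      have h2 : 1 / ((j : ℝ) + 1) ≤ 1 := by
        rw [div_le_one (by positivity)]
        linarith [Nat.cast_nonneg (α := ℝ) j]
      linarith [hρR j])
  have hμE : ∀ j, μ j ∈ energyCone κ := fun j => (hμ j).1.1
  have hν0 : ν = 0 := by
    refine (hlim.vagueTendsto hC hμE hν).eq_zero hν.1 fun K hK => ?_
    obtain ⟨N, hN⟩ := E.exists_superset_of_isCompact hK
    filter_upwards [eventually_ge_atTop N] with j hj
    have hsub : K ⊆ (A \ E j)ᶜ := fun x hx h => h.2 (E.subset hj (hN hx))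
    exact measure_mono_null hsub (hμ j).1.2
  have hself := tendsto_energyForm_self hκ hE hμE hν hlim
  rw [hν0, energyForm_zero_left hκ zero_mem_energyCone] at hself
  have hone : ∀ j, 1 ≤ energyForm κ (μ j) (μ j) * (innerCapacity κ A).toReal := fun j => by
    have h1 := measure_univ_le hκ hE (energyConeOn_mono sdiff_subset (hμ j).1)
    rw [(hμ j).2, ENNReal.le_rpow_inv_iff two_pos, ENNReal.one_rpow] at h1
    have h2 := ENNReal.toReal_mono (ENNReal.mul_ne_top (hμE j).2 hA.ne) h1
    rwa [ENNReal.toReal_one, ENNReal.toReal_mul] at h2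
  have := ge_of_tendsto' (hself.mul_const _) hone
  norm_num at this

/-- If `c_*(A) < ∞`, then no mass of measures of `𝓔⁺(A)` is lost in a strong limit. -/
lemma isStronglyClosed_massClass_eq_one (hκ : IsKernel κ) (hE : EnergyPrinciple κ)
    (hC : ConsistencyPrinciple κ) {A : Set X} (hcap : innerCapacity κ A < ∞)
    (hA : IsStronglyClosed κ (energyConeOn κ A)) :
    IsStronglyClosed κ (massClass κ (· = 1) A) := by
  intro μ ν hμ hν h
  have hμE : ∀ n, μ n ∈ energyCone κ := fun n => (hμ n).1.1
  have hv := h.vagueTendsto hC hμE hν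
  refine ⟨hA μ ν (fun n => (hμ n).1) hν h, le_antisymm
    (hv.measure_le_of_isOpen (fun n => (hμE n).1) hν.1 isOpen_univ fun n => (hμ n).2.le) ?_⟩
  obtain ⟨R, hR, -⟩ := h.exists_energy_le hκ hE hμE hν
  refine ENNReal.le_of_forall_pos_le_add fun δ hδ _ => ?_
  -- With more than δ of mass off K, normalizing that part would give a unit measure of energy at
  -- most R/δ².
  obtain ⟨K, hK, hlt⟩ := exists_isCompact_lt_energyForm hκ hE hC hcap ((R : ℝ) / δ ^ 2)
  have hcompl : ∀ n, μ n Kᶜ ≤ δ := fun n => by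
    by_contra! hcon
    have hρ : (μ n).restrict Kᶜ ∈ energyConeOn κ (A \ K) := by
      refine ⟨restrict_mem_energyCone hκ (hμE n) _, ?_⟩
      rw [sdiff_eq, compl_inter, compl_compl]
      refine measure_union_null (le_antisymm ((Measure.restrict_le_self _).trans_eq (hμ n).1.2)
        bot_le) ?_
      simp [Measure.restrict_apply hK.measurableSet]
    have hle1 : μ n Kᶜ ≤ 1 := (measure_mono (subset_univ _)).trans_eq (hμ n).2
    obtain ⟨σ, hσ, hσ1, hσ2⟩ := exists_unit_smul hκ hρ
      (by rw [Measure.restrict_apply_univ]; exact (bot_le.trans_lt hcon).ne')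
      (by rw [Measure.restrict_apply_univ]; exact (hle1.trans_lt ENNReal.one_lt_top).ne)
    rw [Measure.restrict_apply_univ] at hσ2
    have h1 : (δ : ℝ≥0∞) ^ 2 * energy κ σ ≤ R :=
      calc (δ : ℝ≥0∞) ^ 2 * energy κ σ ≤ μ n Kᶜ ^ 2 * energy κ σ := by gcongr
        _ = energy κ ((μ n).restrict Kᶜ) := hσ2
        _ ≤ energy κ (μ n) := energy_mono hκ (hμE n).1 Measure.restrict_le_self
        _ ≤ R := hR n
    have h2 := ENNReal.toReal_mono ENNReal.coe_ne_top h1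
    rw [ENNReal.toReal_mul, ENNReal.toReal_pow, ENNReal.coe_toReal, ENNReal.coe_toReal] at h2
    have h3 := hlt σ ⟨hσ, hσ1⟩
    rw [div_lt_iff₀ (by positivity)] at h3
    unfold energyForm at h3
    unfold energy at h2
    linarith
  obtain ⟨φ, hφ0, hφ1, hφK, hφG⟩ := exists_urysohn hK isOpen_univ (subset_univ K)
  have h1 : ∀ n, 1 ≤ ENNReal.ofReal (∫ x, φ x ∂(μ n)) + δ := fun n =>
    calc (1 : ℝ≥0∞) = μ n (K ∪ Kᶜ) := by rw [union_compl_self, (hμ n).2]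
      _ ≤ μ n K + μ n Kᶜ := measure_union_le _ _
      _ ≤ _ := add_le_add (measure_le_ofReal_integral (hμE n).1 φ hφ0 hK.measurableSet
        fun x hx => (hφK x hx).ge) (hcompl n)
  have h2 : 1 ≤ ENNReal.ofReal (∫ x, φ x ∂ν) + δ :=
    ge_of_tendsto' (((ENNReal.continuous_ofReal.tendsto _).comp (hv φ)).add_const _) h1
  refine h2.trans ?_
  gcongr
  exact ofReal_integral_le_measure hν.1 φ hφ0 MeasurableSet.univ hφ1 hφG

lemma isStronglyClosed_massClass_le_one (hC : ConsistencyPrinciple κ) {A : Set X}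
    (hA : IsStronglyClosed κ (energyConeOn κ A)) :
    IsStronglyClosed κ (massClass κ (· ≤ 1) A) := fun μ ν hμ hν h =>
  ⟨hA μ ν (fun n => (hμ n).1) hν h, (h.vagueTendsto hC (fun n => (hμ n).1.1)
    hν).measure_le_of_isOpen (fun n => (hμ n).1.1.1) hν.1 isOpen_univ fun n => (hμ n).2⟩

/-- If `ω^A(X) > 1`, then the minimizer over the measures of mass at most one has mass one. -/
lemma measure_univ_eq_one_of_minimizer (hκ : IsKernel κ) (hE : EnergyPrinciple κ) {A : Set X}
    {ω ν P : Measure X} (hω : ω ∈ radonCone X) (hν : IsInnerBalayage κ ω A ν) (hν1 : 1 < ν univ)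
    (hP : P ∈ massClass κ (· ≤ 1) A)
    (hmin : ∀ μ ∈ massClass κ (· ≤ 1) A,
      quadraticFunctional κ (integralFunctional (potential κ ω)) P ≤
        quadraticFunctional κ (integralFunctional (potential κ ω)) μ) : P univ = 1 := by
  have hfin : ∀ μ ∈ energyConeOn κ A, ∫⁻ x, potential κ ω x ∂μ ≠ ∞ := fun μ hμ => by
    rw [hν.lintegral_eq hκ hE hω hμ]
    exact mutualEnergy_ne_top hE hν.1.1 hμ.1
  by_contra hne
  have hlt : P univ < 1 := lt_of_le_of_ne hP.2 hne
  obtain ⟨p, hp⟩ : ∃ p : ℝ≥0, P univ = p :=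
    ⟨_, (ENNReal.coe_toNNReal (hlt.trans ENNReal.one_lt_top).ne).symm⟩
  have hp1 : (p : ℝ) < 1 := by
    rw [hp] at hlt
    exact_mod_cast hlt
  -- Since P(X) < 1, P + tσ is admissible for small t whenever σ has finite mass m; in `t₀`, m + 1
  -- avoids division by zero.
  have hae : ∀ μ ∈ energyConeOn κ A, ∀ᵐ x ∂μ, potential κ ω x ≤ potential κ P x := by
    intro μ hμ
    refine ae_le_potential_of_forall_lintegral_le hκ (hκ.measurable_potential hω) hP.1.1 (A := A)
      (fun σ hσ hσm => ?_) hμ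
    refine (ENNReal.toReal_le_toReal (hfin σ hσ) (mutualEnergy_ne_top hE hP.1.1 hσ.1)).1 ?_
    obtain ⟨m, hm⟩ : ∃ m : ℝ≥0, σ univ = m := ⟨_, (ENNReal.coe_toNNReal hσm).symm⟩
    refine integralFunctional_le_of_variation hκ hE hP.1.1 hσ.1 (hfin P hP.1) (hfin σ hσ)
      (t₀ := (1 - p) / (m + 1)) (div_pos (by linarith) (by positivity)) fun t _ ht => ?_
    refine hmin _ ⟨add_mem_energyConeOn hκ hE hP.1 (smul_mem_energyConeOn hκ hσ t), ?_⟩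
    have h1 : (P + t • σ) univ = ((p + t * m : ℝ≥0) : ℝ≥0∞) := by
      rw [Measure.add_apply, Measure.smul_apply, hp, hm, ENNReal.smul_def, smul_eq_mul]
      push_cast
      rfl
    have h2 : (p : ℝ) + t * m ≤ 1 := by
      have := (le_div_iff₀ (by positivity)).1 ht
      have : (0 : ℝ) ≤ t := t.2
      linarith
    change (P + t • σ) univ ≤ 1
    rw [h1]
    exact_mod_cast h2
  have hself : energyForm κ P P ≤ energyForm κ ν P := by
    have h1 := energyForm_self_le_of_variation hκ hP.1.1 fun t ht =>
      hmin _ ⟨smul_mem_energyConeOn hκ hP.1 t, by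
        change (t • P) univ ≤ 1
        rw [Measure.smul_apply, ENNReal.smul_def, smul_eq_mul]
        exact mul_le_one' (by exact_mod_cast ht) hP.2⟩
    refine h1.trans_eq ?_
    unfold integralFunctional energyForm
    rw [hν.lintegral_eq hκ hE hω hP.1]
  have hνν : energyForm κ ν ν ≤ energyForm κ ν P := by
    refine ENNReal.toReal_mono (mutualEnergy_ne_top hE hν.1.1 hP.1.1) ?_
    rw [← hν.lintegral_eq hκ hE hω hν.1, mutualEnergy_eq_lintegral hκ hP.1.1.1]
    exact lintegral_mono_ae (hae ν hν.1)
  -- I(P) and I(ν) are both at most I(ν, P), so ‖ν - P‖² ≤ 0.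
  have heq : ν = P := eq_of_energyForm_le hE hν.1.1 hP.1.1 (by linarith)
  exact absurd hlt (not_lt.2 (heq ▸ hν1.le))

/-- Under Frostman's maximum principle the total mass of the balayage is monotone. -/
lemma IsInnerBalayage.measure_univ_mono (hκ : IsKernel κ) (hE : EnergyPrinciple κ)
    (hC : ConsistencyPrinciple κ) (hF : FrostmanPrinciple κ) {A B : Set X} (hAB : A ⊆ B)
    {ω ν ν' : Measure X} (hω : ω ∈ radonCone X) (h : IsInnerBalayage κ ω A ν)
    (h' : IsInnerBalayage κ ω B ν') : ν univ ≤ ν' univ := by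
  refine le_of_forall_lt_imp_le_of_dense fun r hr => ?_
  obtain ⟨K, hKA, hK, hrK⟩ := exists_isCompact_lt h.1.1.1 h.1.2 hr
  -- The mass estimate with M = 1 and ν' in the role of ω: both potentials agree with U^ω n.e. on K.
  have h1 := measure_univ_le_of_potential_le hκ hE hC hF hK h.1.1 h'.1.1.1 fun μ hμ => by
    have hμA := energyConeOn_mono hKA hμ
    rw [← mutualEnergy_eq_lintegral hκ h.1.1.1, ← mutualEnergy_eq_lintegral hκ h'.1.1.1,
      mutualEnergy_comm hκ hμ.1.1 h.1.1.1, mutualEnergy_comm hκ hμ.1.1 h'.1.1.1,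
      ← h.lintegral_eq hκ hE hω hμA, ← h'.lintegral_eq hκ hE hω (energyConeOn_mono hAB hμA)]
  exact hrK.le.trans (by simpa using h1)

lemma gaussFunctional_eq (hκ : IsKernel κ) {ω μ : Measure X} (hω : ω ∈ radonCone X)
    (hfin : ∫⁻ x, potential κ ω x ∂μ ≠ ∞) :
    gaussFunctional κ ω μ = quadraticFunctional κ (integralFunctional (potential κ ω)) μ := by
  have hm := hκ.measurable_potential hω
  unfold gaussFunctional quadraticFunctional integralFunctional energyForm energy
  rw [integral_neg, integral_toReal hm.aemeasurable (ae_lt_top hm hfin)]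
  ring

lemma weightedConstant_eq (hκ : IsKernel κ) {ω μ : Measure X} (hω : ω ∈ radonCone X)
    (hμ : μ ∈ energyCone κ) (hfin : ∫⁻ x, potential κ ω x ∂μ ≠ ∞) :
    weightedConstant κ ω μ = energyForm κ μ μ - integralFunctional (potential κ ω) μ := by
  have hm := hκ.measurable_potential hω
  have hm' := hκ.measurable_potential hμ.1
  have hfin' : ∫⁻ x, potential κ μ x ∂μ ≠ ∞ := by
    rw [← mutualEnergy_eq_lintegral hκ hμ.1]
    exact hμ.2
  unfold weightedConstant integralFunctional energyForm
  have hi : Integrable (fun x => -(potential κ ω x).toReal) μ :=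
    (integrable_toReal_of_lintegral_ne_top hm.aemeasurable hfin).neg
  rw [integral_add (integrable_toReal_of_lintegral_ne_top hm'.aemeasurable hfin') hi, integral_neg,
    integral_toReal hm.aemeasurable (ae_lt_top hm hfin),
    integral_toReal hm'.aemeasurable (ae_lt_top hm' hfin'), mutualEnergy_eq_lintegral hκ hμ.1]
  ring

/-- If the minimizers over a class of measures with suitable masses have mass one, then they are
the solutions of the Gauss problem. -/
lemma isGaussSolution_iff (hκ : IsKernel κ) {ω : Measure X} (hω : ω ∈ radonCone X) {A : Set X}
    (hfin : ∀ μ ∈ energyConeOn κ A, ∫⁻ x, potential κ ω x ∂μ ≠ ∞) {p : ℝ≥0∞ → Prop} (hp : p 1)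
    (hex : ∃ P ∈ massClass κ p A, ∀ μ ∈ massClass κ p A,
      quadraticFunctional κ (integralFunctional (potential κ ω)) P ≤
        quadraticFunctional κ (integralFunctional (potential κ ω)) μ)
    (hmass : ∀ P ∈ massClass κ p A, (∀ μ ∈ massClass κ p A,
      quadraticFunctional κ (integralFunctional (potential κ ω)) P ≤
        quadraticFunctional κ (integralFunctional (potential κ ω)) μ) → P univ = 1)
    {l : Measure X} :
    IsGaussSolution κ ω A l ↔ l ∈ massClass κ p A ∧ ∀ μ ∈ massClass κ p A,
      quadraticFunctional κ (integralFunctional (potential κ ω)) l ≤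
        quadraticFunctional κ (integralFunctional (potential κ ω)) μ := by
  have hmem : ∀ μ, μ ∈ gaussClass κ ω A → μ ∈ massClass κ p A := fun μ hμ =>
    ⟨hμ.1, by rw [hμ.2.1]; exact hp⟩
  have heq : ∀ μ ∈ energyConeOn κ A, gaussFunctional κ ω μ =
      quadraticFunctional κ (integralFunctional (potential κ ω)) μ := fun μ hμ =>
    gaussFunctional_eq hκ hω (hfin μ hμ)
  constructor
  · rintro ⟨hl, hmin⟩
    -- A Gauss solution is minimal only among unit measures; the relaxed minimizer P is one of them,
    -- which extends minimality to the whole class.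
    obtain ⟨P, hP, hPmin⟩ := hex
    have hP1 := hmin P ⟨hP.1, hmass P hP hPmin, hfin P hP.1⟩
    rw [heq l hl.1, heq P hP.1] at hP1
    exact ⟨hmem l hl, fun μ hμ => hP1.trans (hPmin μ hμ)⟩
  · rintro ⟨hl, hmin⟩
    refine ⟨⟨hl.1, hmass l hl hmin, hfin l hl.1⟩, fun μ hμ => ?_⟩
    rw [heq l hl.1, heq μ hμ.1]
    exact hmin μ (hmem μ hμ)

/-- Existence, uniqueness and convergence of the solutions of the Gauss problems for a decreasing
sequence of sets. -/
theorem gaussSolutions_convergence (hκ : IsKernel κ) (hE : EnergyPrinciple κ)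
    (hC : ConsistencyPrinciple κ) {A : ℕ → Set X} (hAnti : Antitone A)
    {ω ν : Measure X} (hω : ω ∈ radonCone X) (hν : IsInnerBalayage κ ω (A 0) ν)
    {p : ℝ≥0∞ → Prop} (hp : p 1) (hpmid : ∀ a b, p a → p b → p (2⁻¹ * (a + b)))
    (hclA : ∀ j, IsStronglyClosed κ (energyConeOn κ (A j)))
    (hcl : ∀ B ⊆ A 0, IsStronglyClosed κ (energyConeOn κ B) → IsStronglyClosed κ (massClass κ p B))
    (hne : ∃ μ ∈ energyConeOn κ (⋂ j, A j), μ univ = 1)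
    (hmass : ∀ B, (⋂ j, A j) ⊆ B → B ⊆ A 0 → IsStronglyClosed κ (energyConeOn κ B) →
      ∀ P ∈ massClass κ p B, (∀ μ ∈ massClass κ p B,
        quadraticFunctional κ (integralFunctional (potential κ ω)) P ≤
          quadraticFunctional κ (integralFunctional (potential κ ω)) μ) → P univ = 1) :
    (∀ j, ∃! l : Measure X, IsGaussSolution κ ω (A j) l) ∧
      (∃! l : Measure X, IsGaussSolution κ ω (⋂ j, A j) l) ∧
      ∀ (L : ℕ → Measure X) (l : Measure X),
        (∀ j, IsGaussSolution κ ω (A j) (L j)) → IsGaussSolution κ ω (⋂ j, A j) l →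
          StrongTendsto κ L l ∧ VagueTendsto L l ∧
          Tendsto (fun j => weightedConstant κ ω (L j)) atTop (𝓝 (weightedConstant κ ω l)) := by
  set Λ := integralFunctional (potential κ ω)
  have hfin : ∀ μ ∈ energyConeOn κ (A 0), ∫⁻ x, potential κ ω x ∂μ ≠ ∞ := fun μ hμ => by
    rw [hν.lintegral_eq hκ hE hω hμ]
    exact mutualEnergy_ne_top hE hν.1.1 hμ.1
  have hΛ : ∀ μ ∈ energyConeOn κ (A 0), Λ μ = energyForm κ ν μ := fun μ hμ =>
    congrArg ENNReal.toReal (hν.lintegral_eq hκ hE hω hμ)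
  have hΛc : IsStronglyContinuousOn κ Λ (energyConeOn κ (A 0)) := fun μ σ hμ hσ h => by
    rw [hΛ σ hσ]
    exact (tendsto_energyForm_left hκ hE (fun n => (hμ n).1) hσ.1 hν.1.1 h).congr
      fun n => (hΛ _ (hμ n)).symm
  have hΛa : IsMidpointAffineOn Λ (energyConeOn κ (A 0)) :=
    isMidpointAffineOn_integralFunctional hfin
  -- The functional equals ‖μ - ν‖² - ‖ν‖².
  have hb : ∀ μ ∈ energyConeOn κ (A 0), -energyForm κ ν ν ≤ quadraticFunctional κ Λ μ :=
    fun μ hμ => by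
      unfold quadraticFunctional
      rw [hΛ μ hμ]
      linarith [two_mul_energyForm_le hE hν.1.1 hμ.1]
  have hsub : ∀ B ⊆ A 0, massClass κ p B ⊆ energyConeOn κ (A 0) := fun B hB μ hμ =>
    energyConeOn_mono hB hμ.1
  have hmid := isMidpointConvex_massClass hκ hE hpmid
  obtain ⟨τ, hτ, hτ1⟩ := hne
  have hex : ∀ B, (⋂ j, A j) ⊆ B → B ⊆ A 0 → IsStronglyClosed κ (energyConeOn κ B) →
      ∃ P ∈ massClass κ p B, ∀ μ ∈ massClass κ p B,
        quadraticFunctional κ Λ P ≤ quadraticFunctional κ Λ μ := fun B h1 h2 h3 =>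
    exists_minimizer hκ hE hC (fun _ hμ => hμ.1.1) (hmid B) (hcl B h2 h3)
      ⟨τ, energyConeOn_mono h1 hτ, by rw [hτ1]; exact hp⟩ (hΛa.mono (hsub B h2))
      (hΛc.mono (hsub B h2)) fun μ hμ => hb μ (hsub B h2 hμ)
  have hsol : ∀ B, (⋂ j, A j) ⊆ B → B ⊆ A 0 → IsStronglyClosed κ (energyConeOn κ B) →
      ∀ l, IsGaussSolution κ ω B l ↔ l ∈ massClass κ p B ∧ ∀ μ ∈ massClass κ p B,
        quadraticFunctional κ Λ l ≤ quadraticFunctional κ Λ μ := fun B h1 h2 h3 l =>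
    isGaussSolution_iff hκ hω (fun μ hμ => hfin μ (energyConeOn_mono h2 hμ)) hp (hex B h1 h2 h3)
      (hmass B h1 h2 h3)
  have huniq : ∀ B, (⋂ j, A j) ⊆ B → B ⊆ A 0 → IsStronglyClosed κ (energyConeOn κ B) →
      ∃! l : Measure X, IsGaussSolution κ ω B l := fun B h1 h2 h3 => by
    obtain ⟨P, hP, hPmin⟩ := hex B h1 h2 h3
    refine ⟨P, (hsol B h1 h2 h3 P).2 ⟨hP, hPmin⟩, fun l hl => ?_⟩
    obtain ⟨hl1, hl2⟩ := (hsol B h1 h2 h3 l).1 hl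
    exact eq_of_minimizers hκ hE (fun _ hμ => hμ.1.1) (hmid B) (hΛa.mono (hsub B h2)) hl1 hP hl2
      hPmin
  have hcl' := isStronglyClosed_energyConeOn_iInter hclA
  have hA0 : ∀ j, A j ⊆ A 0 := fun j => hAnti (Nat.zero_le j)
  have hI : ∀ j, (⋂ j, A j) ⊆ A j := iInter_subset A
  refine ⟨fun j => huniq _ (hI j) (hA0 j) (hclA j), huniq _ subset_rfl (hI 0) hcl', ?_⟩
  intro L l hL hl
  have hL' := fun j => (hsol _ (hI j) (hA0 j) (hclA j) (L j)).1 (hL j)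
  have hl' := (hsol _ subset_rfl (hI 0) hcl' l).1 hl
  have hL0 : ∀ j, L j ∈ energyConeOn κ (A 0) := fun j => hsub _ (hA0 j) (hL' j).1
  have hl0 : l ∈ energyConeOn κ (A 0) := hsub _ (hI 0) hl'.1
  have hstrong : StrongTendsto κ L l := by
    rw [massClass_iInter] at hl'
    exact strongTendsto_of_minimizers hκ hE hC (S := fun j => massClass κ p (A j))
      (fun _ hμ => hμ.1.1) (fun i j h => massClass_mono (hAnti h)) (fun j => hmid (A j))
      (fun j => hcl _ (hA0 j) (hclA j))
      (hΛa.mono (hsub _ subset_rfl)) (hΛc.mono (hsub _ subset_rfl)) (fun j => (hL' j).1)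
      (fun j => (hL' j).2) hl'.1 hl'.2
  refine ⟨hstrong, hstrong.vagueTendsto hC (fun j => (hL0 j).1) hl0.1, ?_⟩
  rw [weightedConstant_eq hκ hω hl0.1 (hfin l hl0)]
  simp_rw [fun j => weightedConstant_eq hκ hω (hL0 j).1 (hfin _ (hL0 j))]
  exact (tendsto_energyForm_self hκ hE (fun j => (hL0 j).1) hl0.1 hstrong).sub
    (hΛc L l hL0 hl0 hstrong)

end GaussProblem

/-! ### The main theorem: choice of mass constraint in the two cases. -/

theorem mainTheorem7 {X : Type*} [TopologicalSpace X] [T2Space X] [LocallyCompactSpace X]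
    [SecondCountableTopology X] [MeasurableSpace X] [BorelSpace X]
    (κ : X → X → ℝ≥0∞) (hκ : IsKernel κ)
    (hEnergy : EnergyPrinciple κ) (hConsistency : ConsistencyPrinciple κ)
    (hDomination : DominationPrinciple κ) (hUgaheri : UgaheriPrinciple κ)
    (A : ℕ → Set X) (hAnti : Antitone A) (hQuasi : ∀ j, IsQuasiclosed κ (A j))
    (hPos : 0 < innerCapacity κ (⋂ j, A j))
    (ω : Measure X) (hω : ω ∈ radonCone X) (hω0 : ω ≠ 0)
    (hAdm : IsAdmissibleSource κ ω (A 0)) :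
    (∃! ν : Measure X, IsInnerBalayage κ ω (⋂ j, A j) ν) ∧
    ((innerCapacity κ (A 0) < ∞ ∨
        (FrostmanPrinciple κ ∧
          ∃ ν : Measure X, IsInnerBalayage κ ω (⋂ j, A j) ν ∧ 1 < ν univ)) →
      (∀ j, ∃! l : Measure X, IsGaussSolution κ ω (A j) l) ∧
      (∃! l : Measure X, IsGaussSolution κ ω (⋂ j, A j) l) ∧
      ∀ (L : ℕ → Measure X) (l : Measure X),
        (∀ j, IsGaussSolution κ ω (A j) (L j)) → IsGaussSolution κ ω (⋂ j, A j) l →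
          StrongTendsto κ L l ∧ VagueTendsto L l ∧
          Tendsto (fun j => weightedConstant κ ω (L j)) atTop (𝓝 (weightedConstant κ ω l))) := by
  have hcl : ∀ j, IsStronglyClosed κ (energyConeOn κ (A j)) := fun j =>
    isStronglyClosed_energyConeOn_of_isQuasiclosed hκ hEnergy hConsistency (hQuasi j)
  have hclI := isStronglyClosed_energyConeOn_iInter hcl
  have hbal : ∀ B ⊆ A 0, IsStronglyClosed κ (energyConeOn κ B) → ∃ ν, IsInnerBalayage κ ω B ν :=
    fun B hB hBcl => exists_isInnerBalayage hκ hEnergy hConsistency hDomination hUgaheri hBcl hω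
      (hAdm.mono hB)
  refine ⟨?_, fun hcase => ?_⟩
  · obtain ⟨ν, hν⟩ := hbal _ (iInter_subset A 0) hclI
    exact ⟨ν, hν, fun ν' hν' => hν'.unique hκ hEnergy hω hν⟩
  obtain ⟨ν₀, hν₀⟩ := hbal _ subset_rfl (hcl 0)
  have hne := exists_unit_of_innerCapacity_pos hPos
  rcases hcase with hcap | ⟨hF, ν, hν, hν1⟩
  · exact gaussSolutions_convergence hκ hEnergy hConsistency hAnti hω hν₀ (p := (· = 1)) rfl
      inv_two_mul_add_self_of_eq_one hcl (fun B hB => isStronglyClosed_massClass_eq_one hκ hEnergy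
        hConsistency ((innerCapacity_mono hB).trans_lt hcap)) hne fun _ _ _ _ _ hP _ => hP.2
  · refine gaussSolutions_convergence hκ hEnergy hConsistency hAnti hω hν₀ (p := (· ≤ 1)) le_rfl
      inv_two_mul_add_self_of_le_one hcl
      (fun B _ => isStronglyClosed_massClass_le_one hConsistency) hne fun B h1 h2 h3 P hP hmin => ?_
    obtain ⟨ν', hν'⟩ := hbal B h2 h3
    exact measure_univ_eq_one_of_minimizer hκ hEnergy hω hν'
      -- Every B between the intersection and `A 0` inherits balayage mass above one.
      (hν1.trans_le (hν.measure_univ_mono hκ hEnergy hConsistency hF h1 hω hν')) hP hmin
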